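/- Let $N\ge 3$, $G=\mathrm{GL}_2(\mathbb Z/N\mathbb Z)$, $\zeta_N=e^{2\pi i/N}$, $\sigma=\begin{pmatrix}0&-1\\1&0\end{pmatrix}$, and let $\mathcal H$ be the upper half-plane. Let $E(N)(\mathbb C)=(\mathbb Z^2\rtimes \mathrm{SL}_2(\mathbb Z))\backslash(\mathcal H\times\mathbb C\times G)$ be the universal elliptic curve, where $(m,n)$ acts by $(\tau,z,h)\mapsto(\tau,z+m-n\tau,h)$ and $\gamma=\begin{pmatrix}a&b\\c&d\end{pmatrix}$ by $(\tau,z,h)\mapsto\bigl(\frac{a\tau+b}{c\tau+d},\frac{z}{c\tau+d},\gamma h\bigr)$. The group $G$ acts by $g\cdot(\tau,z,h)=(\tau,z,hg^{T})$. Differential forms on $E(N)(\mathbb C)$ are described by their pull-backs to $\mathcal H\times\mathbb C\times G$. *Eisenstein symbols.* For $u=(a,b)\in(\mathbb Z/N\mathbb Z)^2$, $u\ne(0,0)$, let $$g_{u}(\tau)=q^{\frac12B_2(\{a/N\})}\prod_{n\ge0}\bigl(1-q^{n+\{a/N\}}\zeta_N^{b}\bigr)\prod_{n\ge1}\bigl(1-q^{n-\{a/N\}}\zeta_N^{-b}\bigr),\qquad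 q^r=e^{2\pi i r\tau},$$ where $B_k$ is the $k$-th Bernoulli polynomial and $\{a/N\}\in[0,1)$ is the fractional part. For $v=(c,d)\in(\mathbb Z/N\mathbb Z)^2$ and $r,s\ge0$ with $r+s=1$ let $$F^{r,s}_v(\tau)=\sum_{(m,n)\in\mathbb Z^2\setminus\{(0,0)\}}\frac{e^{2\pi i(md-nc)/N}}{(m\tau+n)^{r+1}(m\bar\tau+n)^{s+1}},\qquad G_v(\tau)=\sum_{(m,n)\in\mathbb Z^2\setminus\{(0,0)\}}\frac{e^{2\pi i(md-nc)/N}}{(m\tau+n)^{3}},$$ and let $\nu=dz-\frac{\operatorname{Im}z}{\operatorname{Im}\tau}\,d\tau$. On the component $h=\sigma$ put $$\mathrm{Eis}^0_{\mathcal D}(u)=\tfrac2N\log|g_u|,\quad \mathrm{Eis}^0_{\mathrm{hol}}(u)=\tfrac2N\,\mathrm{dlog}\,g_u,\quad \mathrm{Eis}^1_{\mathrm{hol}}(v)=-\tfrac{3i}{\pi N}G_v\,d\tau\wedge dz,\quad \mathrm{Eis}^1_{\mathcal D}(v)=\tfrac{3\operatorname{Im}\tau}{2\pi N}\bigl(F^{1,0}_v\,\nu+F^{0,1}_v\,\bar\nu\bigr);$$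 on the component $h\in G$ each of these is given by the same formula with $u$, $v$ replaced by the row vectors $uh^{T}\sigma$, $vh^{T}\sigma$ (so that $g^*\mathrm{Eis}(u)=\mathrm{Eis}(ug)$ for $g\in G$). With $\pi_n(\omega)=\frac12(\omega+(-1)^n\bar\omega)$ define the 2-form $$\mathrm{Eis}^{0,1}_{\mathcal D}(u,v)=\mathrm{Eis}^0_{\mathcal D}(u)\,\pi_2(\mathrm{Eis}^1_{\mathrm{hol}}(v))-\pi_1(\mathrm{Eis}^0_{\mathrm{hol}}(u))\wedge\mathrm{Eis}^1_{\mathcal D}(v).$$ *Shokurov cycles.* For $Q=mX+nY$ with $m,n\in\mathbb Z$ and $\tau_1,\tau_2\in\mathcal H$, let $Q\{\tau_1,\tau_2\}=\{[\tau,t(m\tau+n),\sigma]:\tau\in\{\tau_1,\tau_2\},\,t\in[0,1]\}$, where $\{\tau_1,\tau_2\}$ is the geodesic from $\tau_1$ to $\tau_2$ and the orientation is given by first $\tau$, then $t$. A closed 2-form $\omega$ on $E(N)(\mathbb C)$ *has trivial residues at the cusps* if for every $g\in G$, every $Q=mX+nY$ with $m,n\in\mathbb Z$, and every $\alpha\in\mathbb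 R$ one has $\int_{Q\{iy,\alpha+iy\}}g^*\omega\to0$ as $y\to\infty$. Let $\delta_0(x)=1$ if $x=0$ in $\mathbb Z/N\mathbb Z$ and $\delta_0(x)=0$ otherwise, and $\hat\zeta(x,s)=\sum_{n\ge1}e^{2\pi inx}n^{-s}$. **(1)** Let $u=(a,b)\ne(0,0)$ and $v=(c,d)$ in $(\mathbb Z/N\mathbb Z)^2$, and let $\alpha\in\mathbb R$. Then $$\lim_{y\to\infty}\int_{X\{iy,\alpha+iy\}}\mathrm{Eis}^{0,1}_{\mathcal D}(u,v)=-\frac{4\pi^2}{N^2}\delta_0(a)\log|1-\zeta_N^b|\,B_3(\{c/N\})\,\alpha^2+\frac{3\pi i}{N^2}B_2(\{a/N\})\,\delta_0(c)\bigl(\hat\zeta(-d/N,2)-\hat\zeta(d/N,2)\bigr)\alpha,$$ $$\lim_{y\to\infty}\int_{Y\{iy,\alpha+iy\}}\mathrm{Eis}^{0,1}_{\mathcal D}(u,v)=-\frac{8\pi^2}{N^2}\delta_0(a)\log|1-\zeta_N^b|\,B_3(\{c/N\})\,\alpha,$$ where the terms containing $\delta_0(a)$ are read as $0$ when $a\neq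 0$. **(2)** Let $b,b',d\in\mathbb Z/N\mathbb Z$ with $b\neq0$, $b'\ne0$, such that $d$ is a multiple of both $b$ and $b'$ in $\mathbb Z/N\mathbb Z$, and such that $b\equiv b'$ or $b\equiv-b'\pmod{\gcd(d,N)}$. Then the 2-form $$\mathrm{Eis}^{0,1}_{\mathcal D}((0,b),(0,d))-\mathrm{Eis}^{0,1}_{\mathcal D}((0,b'),(0,d))$$ has trivial residues at the cusps. -/

import Mathlib

open Filter Topology
open scoped Matrix MatrixGroups

noncomputable section

namespace EisSymbol

/-! ### The universal elliptic curve and its differential forms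

Write `G = GL₂(ℤ/N)`. The complex points of the universal elliptic curve are
`E(N)(ℂ) = (ℤ² ⋊ SL₂(ℤ)) \ (𝓗 × ℂ × G)`, where `(m, n)` sends `(τ, z, h)` to `(τ, z + m - nτ, h)`
and `γ = (a b; c d)` sends it to `((aτ + b)/(cτ + d), z/(cτ + d), γh)`.
A differential form on `E(N)(ℂ)` is written through its pull-back to `𝓗 × ℂ × G`: for each `h : G`
a form on the open subset `𝓗 × ℂ` of `ℂ × ℂ`, with coordinates `(τ, z)`. Values at points with
`Im τ ≤ 0` are never used. -/

/-- (Pull-backs of) complex-valued differential 1-forms: component, point, tangent vector. -/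
abbrev OneForm (N : ℕ) : Type := GL (Fin 2) (ZMod N) → ℂ × ℂ → ((ℂ × ℂ) →L[ℝ] ℂ)

/-- (Pull-backs of) complex-valued differential 2-forms. -/
abbrev TwoForm (N : ℕ) : Type := GL (Fin 2) (ZMod N) → ℂ × ℂ → ((ℂ × ℂ) [⋀^Fin 2]→L[ℝ] ℂ)

/-- The matrix `σ = (0 -1; 1 0)`. -/
def sigma (N : ℕ) : GL (Fin 2) (ZMod N) :=
  Matrix.GeneralLinearGroup.mk'' !![0, -1; 1, 0] (by simp [Matrix.det_fin_two])

/-- The transpose of an element of `GL₂(ℤ/N)`. -/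
def glTranspose {N : ℕ} (g : GL (Fin 2) (ZMod N)) : GL (Fin 2) (ZMod N) :=
  Matrix.GeneralLinearGroup.mk'' (g.val)ᵀ
    (by rw [Matrix.det_transpose]; exact (Matrix.isUnit_iff_isUnit_det _).mp g.isUnit)

/-- The pull-back `g^* ω` under the action `g · (τ, z, h) = (τ, z, h gᵀ)` of `g ∈ GL₂(ℤ/N)`. -/
def pullback {N : ℕ} (g : GL (Fin 2) (ZMod N)) (ω : TwoForm N) : TwoForm N :=
  fun h p => ω (h * glTranspose g) p

/-- `dτ`. -/
def dtau : (ℂ × ℂ) →L[ℝ] ℂ := ContinuousLinearMap.fst ℝ ℂ ℂ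

/-- `dz`. -/
def dz : (ℂ × ℂ) →L[ℝ] ℂ := ContinuousLinearMap.snd ℝ ℂ ℂ

/-- Complex conjugation of a 1-form, at a point. -/
def conjOne (α : (ℂ × ℂ) →L[ℝ] ℂ) : (ℂ × ℂ) →L[ℝ] ℂ :=
  (Complex.conjCLE : ℂ →L[ℝ] ℂ).comp α

/-- Complex conjugation of a 2-form, at a point. -/
def conjTwo (ω : (ℂ × ℂ) [⋀^Fin 2]→L[ℝ] ℂ) : (ℂ × ℂ) [⋀^Fin 2]→L[ℝ] ℂ :=
  (Complex.conjCLE : ℂ →L[ℝ] ℂ).compContinuousAlternatingMap ω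

/-- `π₁(α) = (α - ᾱ)/2` on 1-forms. -/
def piOne (α : (ℂ × ℂ) →L[ℝ] ℂ) : (ℂ × ℂ) →L[ℝ] ℂ := (1 / 2 : ℂ) • (α - conjOne α)

/-- `π₂(ω) = (ω + ω̄)/2` on 2-forms. -/
def piTwo (ω : (ℂ × ℂ) [⋀^Fin 2]→L[ℝ] ℂ) : (ℂ × ℂ) [⋀^Fin 2]→L[ℝ] ℂ :=
  (1 / 2 : ℂ) • (ω + conjTwo ω)

/-- The wedge product of two 1-forms at a point (see `wedge_apply`). -/
def wedge (α β : (ℂ × ℂ) →L[ℝ] ℂ) : (ℂ × ℂ) [⋀^Fin 2]→L[ℝ] ℂ :=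
  ContinuousMultilinearMap.alternatization
    ((ContinuousMultilinearMap.mkPiAlgebra ℝ (Fin 2) ℂ).compContinuousLinearMap ![α, β])

theorem wedge_apply (α β : (ℂ × ℂ) →L[ℝ] ℂ) (x y : ℂ × ℂ) :
    wedge α β ![x, y] = α x * β y - α y * β x := by
  have h : (Finset.univ : Finset (Equiv.Perm (Fin 2))) = {1, Equiv.swap 0 1} := by decide
  have h' : (1 : Equiv.Perm (Fin 2)) ≠ Equiv.swap 0 1 := by decide
  simp [wedge, ContinuousMultilinearMap.alternatization_apply_apply, h, Finset.sum_pair h',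
    Fin.prod_univ_succ, sub_eq_add_neg]

/-! ### Eisenstein symbols of weight 0 and 1

All the objects below are indexed by a row vector `u ∈ (ℤ/N)²`. Their restriction to the component
`h` is the restriction to the component `σ` of the object with index `u hᵀ σ`; in this way the
pull-back under `g ∈ GL₂(ℤ/N)` turns the index `u` into `u g`. -/

section

variable {N : ℕ} [NeZero N]

/-- The row vector `u hᵀ σ`. It is `u` itself when `h = σ`. -/
def levelVec (u : Fin 2 → ZMod N) (h : GL (Fin 2) (ZMod N)) : Fin 2 → ZMod N :=
  u ᵥ* ((h.val)ᵀ * (sigma N).val)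

/-- The fractional part `{a/N} ∈ [0, 1)` for `a ∈ ℤ/N`. -/
def frac (a : ZMod N) : ℝ := (a.val : ℝ) / N

/-- `ζ_N^b = exp(2πib/N)`. -/
def zetaPow (b : ZMod N) : ℂ := ZMod.stdAddChar b

/-- The Siegel unit
`g_{a,b}(τ) = q^{B₂({a/N})/2} ∏_{n ≥ 0} (1 - q^{n + {a/N}} ζ_N^b) ∏_{n ≥ 1} (1 - q^{n - {a/N}} ζ_N^{-b})`,
with `q^r = exp(2πirτ)`. -/
def siegelUnit (w : Fin 2 → ZMod N) (τ : ℂ) : ℂ :=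
  Complex.exp (2 * Real.pi * Complex.I * ((bernoulliFun 2 (frac (w 0)) / 2 : ℝ) : ℂ) * τ)
    * (∏' n : ℕ, (1 - Complex.exp (2 * Real.pi * Complex.I * ((n + frac (w 0) : ℝ) : ℂ) * τ)
        * zetaPow (w 1)))
    * (∏' n : ℕ, (1 - Complex.exp (2 * Real.pi * Complex.I * ((n + 1 - frac (w 0) : ℝ) : ℂ) * τ)
        * zetaPow (-(w 1))))

/-- `Eis⁰_𝓓(u) = (2/N) log |g_u|`, pulled back to the universal elliptic curve. -/
def eis0D (u : Fin 2 → ZMod N) (h : GL (Fin 2) (ZMod N)) (p : ℂ × ℂ) : ℂ :=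
  ((2 / N * Real.log ‖siegelUnit (levelVec u h) p.1‖ : ℝ) : ℂ)

/-- `Eis⁰_hol(u) = (2/N) dlog g_u`, pulled back to the universal elliptic curve. -/
def eis0hol (u : Fin 2 → ZMod N) : OneForm N :=
  fun h p => (2 / N * logDeriv (siegelUnit (levelVec u h)) p.1 : ℂ) • dtau

/-- The (absolutely convergent if `j + k ≥ 3`) Eisenstein series
`∑ exp(2πi(md - nc)/N) / ((mτ + n)^j (mτ̄ + n)^k)` over `(m, n) ∈ ℤ² ∖ {(0, 0)}`,
where `w = (c, d)`. -/
def eisSeries (j k : ℕ) (w : Fin 2 → ZMod N) (τ : ℂ) : ℂ :=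
  ∑' x : {x : ℤ × ℤ // x ≠ 0},
    zetaPow ((x.1.1 : ZMod N) * w 1 - (x.1.2 : ZMod N) * w 0)
      / (((x.1.1 : ℂ) * τ + x.1.2) ^ j * ((x.1.1 : ℂ) * starRingEnd ℂ τ + x.1.2) ^ k)

/-- The holomorphic 2-form `Eis¹_hol(v)`. On the component `σ`, for `v = (c, d)`, it is
`-(3i/(πN)) (∑' exp(2πi(md - nc)/N) / (mτ + n)³) dτ ∧ dz`. -/
def eis1hol (v : Fin 2 → ZMod N) : TwoForm N :=
  fun h p => (-(3 * Complex.I) / (Real.pi * N) * eisSeries 3 0 (levelVec v h) p.1 : ℂ)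
    • wedge dtau dz

/-- The 1-form `ν = dz - (Im z / Im τ) dτ`, which is invariant under the translations
`z ↦ z + m - nτ` and restricts to `dz` on the fibres. -/
def nuForm (p : ℂ × ℂ) : (ℂ × ℂ) →L[ℝ] ℂ :=
  dz - ((p.2.im / p.1.im : ℝ) : ℂ) • dtau

/-- Deninger's 1-form `Eis¹_𝓓(v)`, which satisfies `d Eis¹_𝓓(v) = π₁(Eis¹_hol(v))`. On the
component `σ`, for `v = (c, d)`, it is `(3 Im τ / (2πN)) (F^{1,0} ν + F^{0,1} ν̄)` with
`F^{r,s}(τ) = ∑' exp(2πi(md - nc)/N) / ((mτ + n)^{r+1} (mτ̄ + n)^{s+1})`. -/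
def eis1D (v : Fin 2 → ZMod N) : OneForm N :=
  fun h p => ((3 * p.1.im / (2 * Real.pi * N) : ℝ) : ℂ) •
    (eisSeries 2 1 (levelVec v h) p.1 • nuForm p
      + eisSeries 1 2 (levelVec v h) p.1 • conjOne (nuForm p))

/-- `η¹_{u,v} = p^*Eis⁰_𝓓(u) · π₂(Eis¹_hol(v))`. -/
def eta1 (u v : Fin 2 → ZMod N) : TwoForm N :=
  fun h p => eis0D u h p • piTwo (eis1hol v h p)

/-- `η²_{u,v} = -p^*π₁(Eis⁰_hol(u)) ∧ Eis¹_𝓓(v)`. -/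
def eta2 (u v : Fin 2 → ZMod N) : TwoForm N :=
  fun h p => -wedge (piOne (eis0hol u h p)) (eis1D v h p)

/-- The 2-form `Eis^{0,1}_𝓓(u, v) = η¹_{u,v} + η²_{u,v}`, for `u ≠ (0, 0)`. -/
def eis01D (u v : Fin 2 → ZMod N) : TwoForm N := eta1 u v + eta2 u v

/-- `ζ̂(a/N, s)` where `ζ̂(x, s) = ∑_{n ≥ 1} exp(2πinx) / n^s`. -/
def zetaHat (a : ZMod N) (s : ℂ) : ℂ := HurwitzZeta.expZeta (ZMod.toAddCircle a) s

end

/-! ### Shokurov cycles and trivial residues -/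

/-- The geodesic segment of the upper half-plane from `τ₁` to `τ₂`, parametrized by `s ∈ [0, 1]`:
the image of the Euclidean segment from `0` to `w = (τ₂ - τ₁)/(τ₂ - τ̄₁)` in the unit disc (a piece
of a diameter) under the inverse of the Cayley transform `τ ↦ (τ - τ₁)/(τ - τ̄₁)`. -/
def geodesic (τ₁ τ₂ : ℂ) (s : ℝ) : ℂ :=
  let w : ℂ := (τ₂ - τ₁) / (τ₂ - starRingEnd ℂ τ₁)
  (τ₁ - s * w * starRingEnd ℂ τ₁) / (1 - s * w)

/-- The parametrization `(s, t) ↦ (τ, t(mτ + n))`, `τ = geodesic τ₁ τ₂ s`, of the Shokurov cycle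
`(mX + nY){τ₁, τ₂}`, for `s, t ∈ [0, 1]`; the cycle lies in the component `σ`. -/
def shokurovCycle (m n : ℤ) (τ₁ τ₂ : ℂ) (s t : ℝ) : ℂ × ℂ :=
  (geodesic τ₁ τ₂ s, t * (m * geodesic τ₁ τ₂ s + n))

/-- The integral of a 2-form over the Shokurov cycle `(mX + nY){τ₁, τ₂}`, oriented by `(s, t)`
(first the base, then the fibre). -/
def shokurovIntegral {N : ℕ} (m n : ℤ) (τ₁ τ₂ : ℂ) (ω : TwoForm N) : ℂ :=
  ∫ s in (0 : ℝ)..1, ∫ t in (0 : ℝ)..1,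
    ω (sigma N) (shokurovCycle m n τ₁ τ₂ s t)
      ![deriv (fun s' : ℝ => shokurovCycle m n τ₁ τ₂ s' t) s,
        deriv (fun t' : ℝ => shokurovCycle m n τ₁ τ₂ s t') t]

/-- A (closed) 2-form `ω` on `E(N)(ℂ)` has trivial residues at the cusps if, for every
`g ∈ GL₂(ℤ/N)`, every `Q = mX + nY` and every real `α`, the integral of `g^*ω` over
`Q{iy, α + iy}` tends to `0` as `y → ∞`. -/
def HasTrivialResidues {N : ℕ} (ω : TwoForm N) : Prop :=
  ∀ (g : GL (Fin 2) (ZMod N)) (m n : ℤ) (α : ℝ),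
    Tendsto (fun y : ℝ => shokurovIntegral m n (y * Complex.I) (α + y * Complex.I) (pullback g ω))
      atTop (𝓝 0)

end EisSymbol

end

open EisSymbol

noncomputable section

namespace EisSymbol

/-! ### Sums over the integers compared with integrals -/

/-! On the cycle `Q{iy, α + iy}` the form `ν` kills the direction of `s`, since `Im z / Im τ = tm`
there. So the integrand does not depend on `t`, and the double integral becomes a path integral over
the geodesic in `τ` (`pullback_eis01D_apply`). The geodesic lies above height `y` and has bounded
velocity, so only the expansions at the cusp matter. With `Y = Im τ`, and up to `O(Y⁻³)`, the
product expansion gives `log |g_w| ≈ -π B₂ Y + const` and `dlog g_w ≈ πi B₂`. The Eisenstein series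
are summed row by row. The row `m = 0` is the Fourier series of `B₃`. A row `m ≠ 0` is a sum over
`n` twisted by a character: Abel summation makes it negligible if the character is nontrivial, and
otherwise it is close to an integral, whose sum over `m` is a multiple of `Y⁻² (ζ̂(d/N, 2) -
ζ̂(-d/N, 2))` (`norm_eisSeries_sub_le`).

The remaining factors grow at most like `y²`, so all errors together are `O(1/y)`
(`hasOrder_cuspIntegrand_sub`). Substituting the expansions leaves an integrand with an explicit
primitive. Its `B₂ B₃` part is a multiple of `Y² dY` and drops out because both ends have height
`y`; the rest integrates to the stated polynomial in `α` (`cycleIntegrand_leading`,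
`integral_leadingTerm`).

For (2), pulling back by `g` with second row `(p, q)` turns the indices into `(bp, bq)` and `(dp,
dq)`. The logarithmic term needs `bp = 0`; then `dp = 0` because `b ∣ d`, and `B₃(0) = 0` kills it.
The other term needs `dp = 0`; then `gcd(d, N) p = 0`, so `b ≡ ±b'` gives `bp = ±b'p`, and the
evenness of `B₂` makes the two residues equal. -/

theorem hasSum_int_sub_of_tendsto {E : Type*} [NormedAddCommGroup E] [CompleteSpace E] {g : ℤ → E}
    {Lp Lm : E}
    (hs : Summable fun n : ℤ => g (n + 1) - g n)
    (hp : Tendsto (fun n : ℕ => g n) atTop (𝓝 Lp))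
    (hm : Tendsto (fun n : ℕ => g (-n)) atTop (𝓝 Lm)) :
    HasSum (fun n : ℤ => g (n + 1) - g n) (Lp - Lm) := by
  have h1 : HasSum (fun n : ℕ => g ((n : ℤ) + 1) - g n) (Lp - g 0) := by
    have hs1 : Summable (fun n : ℕ => g ((n : ℤ) + 1) - g n) :=
      hs.comp_injective (i := ((↑) : ℕ → ℤ)) Nat.cast_injective
    refine (hs1.hasSum_iff_tendsto_nat).2 ?_
    have : ∀ n : ℕ, ∑ i ∈ Finset.range n, (g ((i : ℤ) + 1) - g i) = g n - g 0 := fun n => by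
      simpa using Finset.sum_range_sub (fun i : ℕ => g i) n
    simp_rw [this]
    exact hp.sub_const _
  have h2 : HasSum (fun n : ℕ => g (-((n : ℤ) + 1) + 1) - g (-((n : ℤ) + 1))) (g 0 - Lm) := by
    have hs1 : Summable (fun n : ℕ => g (-((n : ℤ) + 1) + 1) - g (-((n : ℤ) + 1))) :=
      hs.comp_injective (i := fun n : ℕ => -((n : ℤ) + 1)) (fun a b h => by simpa using h)
    refine (hs1.hasSum_iff_tendsto_nat).2 ?_
    have : ∀ n : ℕ, ∑ i ∈ Finset.range n, (g (-((i : ℤ) + 1) + 1) - g (-((i : ℤ) + 1)))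
        = g 0 - g (-n) := fun n => by
      have := Finset.sum_range_sub' (fun i : ℕ => g (-i)) n
      simp only [Nat.cast_zero, neg_zero] at this
      rw [← this]
      refine Finset.sum_congr rfl fun i _ => ?_
      push_cast
      rw [show (-((i : ℤ) + 1) + 1) = -i by ring]
    simp_rw [this]
    exact tendsto_const_nhds.sub hm
  have := HasSum.of_nat_of_neg_add_one (f := fun n : ℤ => g (n + 1) - g n) h1 h2
  rwa [sub_add_sub_cancel] at this

/-- On each half of `ℤ` the terms are nonnegative and the partial sums telescope to a convergent
sequence. -/
theorem summable_int_sub_of_monotone {g : ℤ → ℝ} (hg : Monotone g) {Lp Lm : ℝ}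
    (hp : Tendsto (fun n : ℕ => g n) atTop (𝓝 Lp))
    (hm : Tendsto (fun n : ℕ => g (-n)) atTop (𝓝 Lm)) :
    Summable fun n : ℤ => g (n + 1) - g n := by
  refine Summable.of_nat_of_neg_add_one (f := fun n : ℤ => g (n + 1) - g n) ?_ ?_
  · refine ((hasSum_iff_tendsto_nat_of_nonneg (r := Lp - g 0)
      (fun i => sub_nonneg.2 (hg (by lia))) ).2 ?_).summable
    have : ∀ n : ℕ, ∑ i ∈ Finset.range n, (g ((i : ℤ) + 1) - g i) = g n - g 0 := fun n => by
      simpa using Finset.sum_range_sub (fun i : ℕ => g i) n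
    simp_rw [this]
    exact hp.sub_const _
  · refine ((hasSum_iff_tendsto_nat_of_nonneg (r := g 0 - Lm)
      (fun i => sub_nonneg.2 (hg (by lia))) ).2 ?_).summable
    have : ∀ n : ℕ, ∑ i ∈ Finset.range n, (g (-((i : ℤ) + 1) + 1) - g (-((i : ℤ) + 1)))
        = g 0 - g (-n) := fun n => by
      have := Finset.sum_range_sub' (fun i : ℕ => g (-i)) n
      simp only [Nat.cast_zero, neg_zero] at this
      rw [← this]
      refine Finset.sum_congr rfl fun i _ => ?_
      push_cast
      rw [show (-((i : ℤ) + 1) + 1) = -i by ring]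
    simp_rw [this]
    exact tendsto_const_nhds.sub hm

/-- Since `|x - t| ≤ 1 ≤ |a|`, one has `x² ≤ 2t² + 2 ≤ 2t² + 2a²`, whence the factor 3. -/
theorem inv_sq_add_sq_le {a x t : ℝ} (ha : 1 ≤ |a|) (h1 : x ≤ t) (h2 : t ≤ x + 1) :
    1 / (t ^ 2 + a ^ 2) ≤ 3 / (x ^ 2 + a ^ 2) := by
  have ha2 : 1 ≤ a ^ 2 := by rw [← sq_abs]; nlinarith
  rw [div_le_div_iff₀ (by positivity) (by positivity)]
  nlinarith [sq_nonneg (2 * t - x), sq_nonneg (t - x), sq_nonneg (t + (t - x)), sq_nonneg (t - (t-x))]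

/-- Each term is at most a constant times an increment of `arctan (· / |a|)`, and these increments
telescope to `π`. -/
theorem sum_inv_sq_add_sq (x : ℝ) {a : ℝ} (ha : 1 ≤ |a|) :
    Summable (fun n : ℤ => 1 / ((x + n) ^ 2 + a ^ 2)) ∧
      ∑' n : ℤ, 1 / ((x + n) ^ 2 + a ^ 2) ≤ 3 * Real.pi / |a| := by
  have hpos : 0 < |a| := by linarith
  have ha2 : 0 < a ^ 2 := by rw [← sq_abs]; positivity
  set g : ℤ → ℝ := fun n => Real.arctan ((x + n) / |a|) with hg
  have hmono : Monotone g := fun m n h => by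
    refine Real.arctan_strictMono.monotone ?_
    have : (m : ℝ) ≤ n := by exact_mod_cast h
    gcongr
  have hp : Tendsto (fun n : ℕ => g n) atTop (𝓝 (Real.pi / 2)) := by
    refine (Real.tendsto_arctan_atTop.mono_right nhdsWithin_le_nhds).comp ?_
    refine Tendsto.atTop_div_const hpos ?_
    simpa using tendsto_atTop_add_const_left _ x tendsto_natCast_atTop_atTop
  have hm : Tendsto (fun n : ℕ => g (-n)) atTop (𝓝 (-(Real.pi / 2))) := by
    refine (Real.tendsto_arctan_atBot.mono_right nhdsWithin_le_nhds).comp ?_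
    refine Tendsto.atBot_div_const hpos ?_
    simpa using tendsto_atBot_add_const_left _ x (tendsto_neg_atTop_atBot.comp
      tendsto_natCast_atTop_atTop)
  have hs := summable_int_sub_of_monotone hmono hp hm
  have hsum := hasSum_int_sub_of_tendsto hs hp hm
  have hle : ∀ n : ℤ, 1 / ((x + n) ^ 2 + a ^ 2) ≤ 3 / |a| * (g (n + 1) - g n) := fun n => by
    have hd : ∀ t : ℝ, HasDerivAt (fun t => Real.arctan (t / |a|)) (|a| / (t ^ 2 + a ^ 2)) t :=
      fun t => by
        have h := ((hasDerivAt_id t).div_const |a|).arctan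
        convert! h using 1
        simp only [id]
        rw [div_pow, sq_abs]
        field_simp
        rw [sq_abs, mul_add, mul_div_cancel₀ _ ha2.ne']
        ring
    obtain ⟨t, ⟨ht1, ht2⟩, ht⟩ := exists_hasDerivAt_eq_slope (fun t => Real.arctan (t / |a|))
      (fun t => |a| / (t ^ 2 + a ^ 2)) (show x + n < x + n + 1 by linarith)
      (fun t _ => (hd t).continuousAt.continuousWithinAt) (fun t _ => hd t)
    have h3 : g (n + 1) - g n = |a| / (t ^ 2 + a ^ 2) := by
      rw [ht]
      simp [hg, add_assoc]
    rw [h3]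
    -- The comparison is needed with the left endpoint on the small side; changing signs reverses
    -- the order of the two points.
    have h4 := inv_sq_add_sq_le (x := -t) (t := -(x + n)) ha (by linarith) (by linarith)
    rw [neg_sq, neg_sq] at h4
    refine h4.trans (le_of_eq ?_)
    field_simp
  have hs1 : Summable (fun n : ℤ => 1 / ((x + n) ^ 2 + a ^ 2)) :=
    Summable.of_nonneg_of_le (fun n => by positivity) hle (hs.mul_left _)
  refine ⟨hs1, ?_⟩
  refine (hs1.tsum_le_tsum hle (hs.mul_left _)).trans (le_of_eq ?_)
  rw [tsum_mul_left, hsum.tsum_eq]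
  ring

theorem sum_inv_sq_add_sq_sq (x : ℝ) {a : ℝ} (ha : 1 ≤ |a|) :
    Summable (fun n : ℤ => 1 / ((x + n) ^ 2 + a ^ 2) ^ 2) ∧
      ∑' n : ℤ, 1 / ((x + n) ^ 2 + a ^ 2) ^ 2 ≤ 10 / |a| ^ 3 := by
  have hpos : 0 < |a| := by linarith
  have ha2 : 0 < a ^ 2 := by rw [← sq_abs]; positivity
  obtain ⟨h1, h2⟩ := sum_inv_sq_add_sq x ha
  have hle : ∀ n : ℤ, 1 / ((x + n) ^ 2 + a ^ 2) ^ 2 ≤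
      1 / a ^ 2 * (1 / ((x + n) ^ 2 + a ^ 2)) := fun n => by
    have h3 : a ^ 2 ≤ (x + n) ^ 2 + a ^ 2 := le_add_of_nonneg_left (sq_nonneg _)
    rw [one_div_mul_one_div]
    refine one_div_le_one_div_of_le (by positivity) ?_
    rw [sq ((x + n) ^ 2 + a ^ 2)]
    gcongr
  have hs := Summable.of_nonneg_of_le (fun n => by positivity) hle (h1.mul_left _)
  refine ⟨hs, (hs.tsum_le_tsum hle (h1.mul_left _)).trans ?_⟩
  rw [tsum_mul_left]
  calc 1 / a ^ 2 * ∑' n : ℤ, 1 / ((x + n) ^ 2 + a ^ 2) ≤ 1 / a ^ 2 * (3 * Real.pi / |a|) := by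
        gcongr
    _ = 3 * Real.pi / |a| ^ 3 := by rw [← sq_abs]; field_simp
    -- The constant 10 is a bound for `3π`.
    _ ≤ _ := by gcongr; linarith [Real.pi_lt_d2]

/-- A function on the line whose derivative is at most `3 / (x² + a²)²`. -/
theorem norm_sub_le_of_deriv_bound {f f' : ℝ → ℂ} {a : ℝ} (ha : 1 ≤ |a|)
    (hf : ∀ x, HasDerivAt f (f' x) x) (hb : ∀ x, ‖f' x‖ ≤ 3 / (x ^ 2 + a ^ 2) ^ 2)
    {x t : ℝ} (h1 : x ≤ t) (h2 : t ≤ x + 1) :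
    ‖f t - f x‖ ≤ 27 / (x ^ 2 + a ^ 2) ^ 2 := by
  have ha2 : 0 < a ^ 2 := by rw [← sq_abs]; positivity
  have key := norm_image_sub_le_of_norm_deriv_le_segment' (f := f) (f' := f') (a := x) (b := x + 1)
    (C := 27 / (x ^ 2 + a ^ 2) ^ 2) (fun t _ => (hf t).hasDerivWithinAt) (fun t ht => by
      refine (hb t).trans ?_
      have := inv_sq_add_sq_le ha ht.1 ht.2.le
      calc 3 / (t ^ 2 + a ^ 2) ^ 2 = 3 * (1 / (t ^ 2 + a ^ 2)) ^ 2 := by rw [div_pow]; ring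
        _ ≤ 3 * (3 / (x ^ 2 + a ^ 2)) ^ 2 := by gcongr
        _ = _ := by rw [div_pow]; ring) t ⟨h1, h2⟩
  refine key.trans ?_
  exact mul_le_of_le_one_right (by positivity) (by linarith)

/-- Mean value inequality for `t ↦ F t - t f(x)`, whose derivative is `f t - f x`. -/
theorem norm_primitive_sub_le {F f f' : ℝ → ℂ} {a : ℝ} (ha : 1 ≤ |a|)
    (hF : ∀ x, HasDerivAt F (f x) x)
    (hf : ∀ x, HasDerivAt f (f' x) x) (hb : ∀ x, ‖f' x‖ ≤ 3 / (x ^ 2 + a ^ 2) ^ 2) (x : ℝ) :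
    ‖f x - (F (x + 1) - F x)‖ ≤ 27 / (x ^ 2 + a ^ 2) ^ 2 := by
  have key := norm_image_sub_le_of_norm_deriv_le_segment' (f := fun t : ℝ => F t - t * f x)
    (f' := fun t => f t - f x) (a := x) (b := x + 1)
    (C := 27 / (x ^ 2 + a ^ 2) ^ 2) (fun t _ => by
      have h := (hF t).sub ((Complex.ofRealCLM.hasDerivAt (x := t)).mul_const (f x))
      rw [Complex.ofRealCLM_apply, Complex.ofReal_one, one_mul] at h
      exact h.hasDerivWithinAt)
    (fun t ht => norm_sub_le_of_deriv_bound ha hf hb ht.1 ht.2.le) (x + 1) ⟨by linarith, le_rfl⟩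
  rw [norm_sub_rev]
  calc _ = ‖F (x + 1) - ↑(x + 1) * f x - (F x - ↑x * f x)‖ := by congr 1; push_cast; ring
    _ ≤ _ := key.trans (by simp)

/-- Abel summation: multiplying by `1 - ω` replaces `f` by its differences, which are controlled by
`f'`. -/
theorem norm_tsum_twisted_le {f f' : ℝ → ℂ} {a : ℝ} (ha : 1 ≤ |a|)
    (hf : ∀ x, HasDerivAt f (f' x) x) (hb : ∀ x, ‖f' x‖ ≤ 3 / (x ^ 2 + a ^ 2) ^ 2) (x : ℝ)
    (hs : Summable fun n : ℤ => f (x + n)) {ω : ℂ} (hω : ‖ω‖ = 1) (hω1 : ω ≠ 1) :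
    ‖∑' n : ℤ, ω ^ n * f (x + n)‖ ≤ 270 / ‖1 - ω‖ / |a| ^ 3 := by
  have hω0 : ω ≠ 0 := by rintro rfl; simp at hω
  have hpos : 0 < ‖1 - ω‖ := norm_pos_iff.2 (sub_ne_zero.2 hω1.symm)
  have hs1 : Summable fun n : ℤ => ω ^ n * f (x + n) :=
    Summable.of_norm (by simpa [hω] using hs.norm)
  have hs2 : Summable fun n : ℤ => ω ^ (n + 1) * f (x + n) :=
    Summable.of_norm (by simpa [hω] using hs.norm)
  have hs3 : Summable fun n : ℤ => ω ^ (n + 1) * f (x + (n + 1)) := by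
    have := hs1.comp_injective (add_left_injective (1 : ℤ))
    simpa [Function.comp_def] using this
  have hshift : ∑' n : ℤ, ω ^ (n + 1) * f (x + (n + 1)) = ∑' n : ℤ, ω ^ n * f (x + n) := by
    have := (Equiv.addRight (1 : ℤ)).tsum_eq fun n : ℤ => ω ^ n * f (x + n)
    simpa using this
  have hmul : ∑' n : ℤ, ω ^ (n + 1) * f (x + n) = ω * ∑' n : ℤ, ω ^ n * f (x + n) := by
    rw [← tsum_mul_left]
    refine tsum_congr fun n => ?_
    rw [zpow_add_one₀ hω0]; ring
  have key : (1 - ω) * ∑' n : ℤ, ω ^ n * f (x + n)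
      = ∑' n : ℤ, ω ^ (n + 1) * (f (x + (n + 1)) - f (x + n)) := by
    simp_rw [mul_sub]
    rw [hs3.tsum_sub hs2, hshift, hmul]; ring
  obtain ⟨h1, h2⟩ := sum_inv_sq_add_sq_sq x ha
  have hbd : ‖(1 - ω) * ∑' n : ℤ, ω ^ n * f (x + n)‖ ≤ 27 * (10 / |a| ^ 3) := by
    rw [key]
    refine (tsum_of_norm_bounded (h1.mul_left 27).hasSum fun n => ?_).trans ?_
    · have := norm_sub_le_of_deriv_bound ha hf hb (x := x + n) (t := x + (n + 1)) (by linarith)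
        (by linarith)
      rw [norm_mul, norm_zpow, hω, one_zpow, one_mul]
      exact this.trans (le_of_eq (by ring))
    · rw [tsum_mul_left]; gcongr
  rw [norm_mul] at hbd
  rw [div_right_comm, le_div_iff₀ hpos, mul_comm]
  exact hbd.trans (le_of_eq (by ring))

/-- `Lp - Lm` is the integral of `f` over the line; it is cut into unit intervals, and the errors
are summed. -/
theorem norm_tsum_sub_integral_le {F f f' : ℝ → ℂ} {a : ℝ} (ha : 1 ≤ |a|)
    (hF : ∀ x, HasDerivAt F (f x) x)
    (hf : ∀ x, HasDerivAt f (f' x) x) (hb : ∀ x, ‖f' x‖ ≤ 3 / (x ^ 2 + a ^ 2) ^ 2) (x : ℝ)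
    (hs : Summable fun n : ℤ => f (x + n)) {Lp Lm : ℂ} (hp : Tendsto F atTop (𝓝 Lp))
    (hm : Tendsto F atBot (𝓝 Lm)) :
    ‖∑' n : ℤ, f (x + n) - (Lp - Lm)‖ ≤ 270 / |a| ^ 3 := by
  obtain ⟨h1, h2⟩ := sum_inv_sq_add_sq_sq x ha
  have hle : ∀ n : ℤ, ‖f (x + n) - (F (x + (n + 1 : ℤ)) - F (x + n))‖ ≤
      27 * (1 / ((x + n) ^ 2 + a ^ 2) ^ 2) := fun n => by
    have := norm_primitive_sub_le ha hF hf hb (x + n)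
    push_cast
    rw [← add_assoc]
    exact this.trans (le_of_eq (by ring))
  have hs1 : Summable fun n : ℤ => f (x + n) - (F (x + (n + 1 : ℤ)) - F (x + n)) :=
    Summable.of_norm_bounded (h1.mul_left 27) hle
  have hs2 : Summable fun n : ℤ => F (x + (n + 1 : ℤ)) - F (x + n) := by
    simpa using hs.sub hs1
  have hsum := hasSum_int_sub_of_tendsto (g := fun n : ℤ => F (x + n)) hs2
    (hp.comp (by simpa using tendsto_atTop_add_const_left _ x tendsto_natCast_atTop_atTop))
    (hm.comp (by simpa using tendsto_atBot_add_const_left _ x (tendsto_neg_atTop_atBot.comp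
      tendsto_natCast_atTop_atTop)))
  rw [← hsum.tsum_eq, ← hs.tsum_sub hs2]
  refine (tsum_of_norm_bounded (h1.mul_left 27).hasSum hle).trans ?_
  rw [tsum_mul_left]
  calc 27 * ∑' n : ℤ, 1 / ((x + n) ^ 2 + a ^ 2) ^ 2 ≤ 27 * (10 / |a| ^ 3) := by gcongr
    _ = _ := by ring

/-! ### Rows of the Eisenstein series -/

/-- The function `x ↦ 1 / ((x + ia)^j (x - ia)^k)`. -/
def rowKernel (j k : ℕ) (a x : ℝ) : ℂ :=
  1 / (((x : ℂ) + a * Complex.I) ^ j * ((x : ℂ) - a * Complex.I) ^ k)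

theorem norm_sq_add_mul_I (x a : ℝ) : ‖(x : ℂ) + a * Complex.I‖ ^ 2 = x ^ 2 + a ^ 2 := by
  rw [← Complex.normSq_eq_norm_sq, Complex.normSq_add_mul_I]

theorem norm_sub_mul_I (x a : ℝ) : ‖(x : ℂ) - a * Complex.I‖ = ‖(x : ℂ) + a * Complex.I‖ := by
  rw [← Complex.norm_conj]; simp

theorem add_mul_I_ne_zero (x : ℝ) {a : ℝ} (ha : a ≠ 0) : (x : ℂ) + a * Complex.I ≠ 0 := fun h =>
  ha (by simpa using congrArg Complex.im h)

theorem sub_mul_I_ne_zero (x : ℝ) {a : ℝ} (ha : a ≠ 0) : (x : ℂ) - a * Complex.I ≠ 0 := fun h =>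
  ha (by simpa using congrArg Complex.im h)

theorem norm_rowKernel (j k : ℕ) (a x : ℝ) :
    ‖rowKernel j k a x‖ = 1 / ‖(x : ℂ) + a * Complex.I‖ ^ (j + k) := by
  rw [rowKernel, norm_div, norm_mul, norm_pow, norm_pow, norm_sub_mul_I, norm_one, pow_add]

theorem norm_rowKernel_le {j k : ℕ} (h : j + k = 3) {a : ℝ} (ha : 1 ≤ |a|) (x : ℝ) :
    ‖rowKernel j k a x‖ ≤ 1 / (x ^ 2 + a ^ 2) := by
  have hpos : 0 < |a| := by linarith
  have h1 : 1 ≤ ‖(x : ℂ) + a * Complex.I‖ := ha.trans (by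
    simpa using Complex.abs_im_le_norm ((x : ℂ) + a * Complex.I))
  rw [norm_rowKernel, h, ← norm_sq_add_mul_I]
  exact one_div_le_one_div_of_le (by positivity) (pow_le_pow_right₀ h1 (by norm_num))

/-- The kernel `k a x` has a derivative of size `(x² + a²)⁻²` and its integral over the line is
`c a / |a|³`. -/
def IsRowKernel (k : ℝ → ℝ → ℂ) (c : ℂ) : Prop :=
  ∀ a : ℝ, 1 ≤ |a| → ∃ (F f' : ℝ → ℂ) (Lp Lm : ℂ), (∀ x, HasDerivAt F (k a x) x) ∧
    (∀ x, HasDerivAt (k a) (f' x) x) ∧ (∀ x, ‖f' x‖ ≤ 3 / (x ^ 2 + a ^ 2) ^ 2) ∧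
    Tendsto F atTop (𝓝 Lp) ∧ Tendsto F atBot (𝓝 Lm) ∧ Lp - Lm = c * ((a / |a| ^ 3 : ℝ) : ℂ)

theorem hasDerivAt_ofReal_add (x : ℝ) (c : ℂ) : HasDerivAt (fun x : ℝ => (x : ℂ) + c) 1 x := by
  simpa using (Complex.ofRealCLM.hasDerivAt (x := x)).add_const c

theorem tendsto_inv_add_const (c : ℂ) {l : Filter ℝ} (hl : l ≤ cocompact ℝ) :
    Tendsto (fun x : ℝ => ((x : ℂ) + c)⁻¹) l (𝓝 0) := by
  rw [tendsto_zero_iff_norm_tendsto_zero]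
  simp_rw [norm_inv]
  refine tendsto_inv_atTop_zero.comp ?_
  refine tendsto_norm_cocompact_atTop.comp ?_
  have h1 : Tendsto (fun z : ℂ => z + c) (cocompact ℂ) (cocompact ℂ) :=
    (Homeomorph.addRight c).isClosedEmbedding.tendsto_cocompact
  exact h1.comp ((Complex.isometry_ofReal.isClosedEmbedding.tendsto_cocompact).mono_left hl)

theorem isRowKernel_three_zero : IsRowKernel (rowKernel 3 0) 0 := fun a ha => by
  have ha0 : a ≠ 0 := by rintro rfl; simp at ha; linarith
  have hA := fun x : ℝ => add_mul_I_ne_zero x ha0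
  refine ⟨fun x => -(1 / 2) * (((x : ℂ) + a * Complex.I)⁻¹) ^ 2,
    fun x => -3 * (((x : ℂ) + a * Complex.I)⁻¹) ^ 4, 0, 0, fun x => ?_, fun x => ?_, fun x => ?_,
    ?_, ?_, by simp⟩
  · have h := (((hasDerivAt_ofReal_add x (a * Complex.I)).fun_inv (hA x)).fun_pow 2).const_mul
      (-(1 / 2) : ℂ)
    convert! h using 1
    have := hA x
    simp only [rowKernel]
    norm_num
    field_simp
  · have h := ((hasDerivAt_ofReal_add x (a * Complex.I)).fun_inv (hA x)).fun_pow 3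
    convert! h using 1
    · ext y; simp [rowKernel]
    · have := hA x
      norm_num
      field_simp
  · rw [norm_mul, norm_pow, norm_inv, ← norm_sq_add_mul_I, ← pow_mul]
    simp [div_eq_mul_inv]
  · simpa using ((tendsto_inv_add_const (a * Complex.I) atTop_le_cocompact).pow 2).const_mul
      (-(1 / 2) : ℂ)
  · simpa using ((tendsto_inv_add_const (a * Complex.I) atBot_le_cocompact).pow 2).const_mul
      (-(1 / 2) : ℂ)

/-- The primitive comes from partial fractions: with `A = x + ia` and `B = x - ia`, `1/(A²B) =
(1/(AB) - 1/A²)/(2ia)`, and `AB = x² + a²` produces the arctangent, the only part with different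
limits at the two ends. Writing it with `|a|` covers both signs of `a`. -/
theorem isRowKernel_two_one : IsRowKernel (rowKernel 2 1) (-(Real.pi * Complex.I / 2)) :=
    fun a ha => by
  have ha0 : a ≠ 0 := by rintro rfl; simp at ha; linarith
  have hpos : 0 < |a| := by linarith
  have ha2 : 0 < a ^ 2 := by positivity
  have hA := fun x : ℝ => add_mul_I_ne_zero x ha0
  have hB := fun x : ℝ => sub_mul_I_ne_zero x ha0
  have hsq : ∀ x : ℝ, ((x : ℂ) + a * Complex.I) * (x - a * Complex.I) = x ^ 2 + a ^ 2 := fun x => by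
    ring_nf; simp
  have hac : (a : ℂ) ≠ 0 := by exact_mod_cast ha0
  have hdA : ∀ x, HasDerivAt (fun x : ℝ => ((x : ℂ) + a * Complex.I)⁻¹) _ x :=
    fun x => (hasDerivAt_ofReal_add x (a * Complex.I)).fun_inv (hA x)
  have hdB : ∀ x, HasDerivAt (fun x : ℝ => ((x : ℂ) - a * Complex.I)⁻¹) _ x := fun x => by
    have := (hasDerivAt_ofReal_add x (-(a * Complex.I))).fun_inv
      (by simpa [← sub_eq_add_neg] using hB x)
    simpa only [← sub_eq_add_neg] using this
  have hatan : ∀ x : ℝ, HasDerivAt (fun x : ℝ => ((Real.arctan (x / |a|) : ℝ) : ℂ))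
      ((|a| / (x ^ 2 + a ^ 2) : ℝ) : ℂ) x := fun x => by
    have h := (((hasDerivAt_id x).div_const |a|).arctan).ofReal_comp
    convert! h using 1
    congr 1
    simp only [id]
    rw [div_pow, sq_abs]
    field_simp
    rw [sq_abs]
    ring
  refine ⟨fun x => -Complex.I / (2 * a) * ((x : ℂ) + a * Complex.I)⁻¹
      - Complex.I * a / (2 * (|a| : ℝ) ^ 3) * ((Real.arctan (x / |a|) : ℝ) : ℂ),
    fun x => -(2 * ((((x : ℂ) + a * Complex.I)⁻¹) ^ 3 * ((x : ℂ) - a * Complex.I)⁻¹)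
      + (((x : ℂ) + a * Complex.I)⁻¹) ^ 2 * (((x : ℂ) - a * Complex.I)⁻¹) ^ 2),
    - Complex.I * a / (2 * (|a| : ℝ) ^ 3) * ((Real.pi / 2 : ℝ) : ℂ),
    - Complex.I * a / (2 * (|a| : ℝ) ^ 3) * ((-(Real.pi / 2) : ℝ) : ℂ),
    fun x => ?_, fun x => ?_, fun x => ?_, ?_, ?_, ?_⟩
  · have h := ((hdA x).const_mul (-Complex.I / (2 * a))).sub
      ((hatan x).const_mul (Complex.I * a / (2 * (|a| : ℝ) ^ 3)))
    convert! h using 1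
    have h1 := hA x
    have h2 := hB x
    have h3 : ((|a| : ℝ) : ℂ) ≠ 0 := by exact_mod_cast hpos.ne'
    have h4 : ((|a| : ℝ) : ℂ) ^ 2 = a ^ 2 := by exact_mod_cast sq_abs a
    have h5 : ((|a| : ℝ) : ℂ) ^ 3 = |a| * a ^ 2 := by rw [← h4]; ring
    simp only [rowKernel]
    push_cast
    rw [h5, ← hsq]
    field_simp
    ring_nf
    simp
  · have h := ((hdA x).fun_pow 2).mul (hdB x)
    convert! h using 1
    · ext y; simp [rowKernel, mul_comm]
    · have := hA x
      have := hB x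
      norm_num
      field_simp
      ring
  · rw [norm_neg]
    refine (norm_add_le _ _).trans (le_of_eq ?_)
    simp only [norm_mul, norm_pow, norm_inv, norm_sub_mul_I]
    rw [← norm_sq_add_mul_I]
    have : ‖(x : ℂ) + a * Complex.I‖ ≠ 0 := norm_ne_zero_iff.2 (hA x)
    field_simp
    norm_num
  · have h1 := (tendsto_inv_add_const (a * Complex.I) atTop_le_cocompact).const_mul
      (-Complex.I / (2 * a))
    have h2 := ((Complex.continuous_ofReal.tendsto _).comp
      ((Real.tendsto_arctan_atTop.mono_right nhdsWithin_le_nhds).comp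
        (tendsto_id.atTop_div_const hpos))).const_mul (Complex.I * a / (2 * (|a| : ℝ) ^ 3))
    convert! h1.sub h2 using 2
    ring
  · have h1 := (tendsto_inv_add_const (a * Complex.I) atBot_le_cocompact).const_mul
      (-Complex.I / (2 * a))
    have h2 := ((Complex.continuous_ofReal.tendsto _).comp
      ((Real.tendsto_arctan_atBot.mono_right nhdsWithin_le_nhds).comp
        (tendsto_id.atBot_div_const hpos))).const_mul (Complex.I * a / (2 * (|a| : ℝ) ^ 3))
    convert! h1.sub h2 using 2
    ring
  · push_cast
    ring

/-- Replacing `a` by `-a` exchanges the two factors of the kernel. -/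
theorem isRowKernel_one_two : IsRowKernel (rowKernel 1 2) (Real.pi * Complex.I / 2) :=
    fun a ha => by
  obtain ⟨F, f', Lp, Lm, h1, h2, h3, h4, h5, h6⟩ := isRowKernel_two_one (-a) (by rwa [abs_neg])
  have h : rowKernel 2 1 (-a) = rowKernel 1 2 a := by
    ext x
    simp only [rowKernel]
    push_cast
    ring_nf
  rw [h] at h1 h2
  rw [neg_sq] at h3
  refine ⟨F, f', Lp, Lm, h1, h2, h3, h4, h5, ?_⟩
  rw [h6, abs_neg]
  push_cast
  ring

section

variable {N : ℕ} [NeZero N]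

theorem norm_zetaPow (b : ZMod N) : ‖zetaPow b‖ = 1 := by
  rw [zetaPow, ZMod.stdAddChar_apply, Circle.norm_coe]

theorem zetaPow_add (a b : ZMod N) : zetaPow (a + b) = zetaPow a * zetaPow b :=
  AddChar.map_add_eq_mul _ _ _

theorem zetaPow_zero : zetaPow (0 : ZMod N) = 1 := AddChar.map_zero_eq_one _

theorem zetaPow_intCast_mul (n : ℤ) (b : ZMod N) : zetaPow ((n : ZMod N) * b) = zetaPow b ^ n := by
  rw [← zsmul_eq_mul]
  exact AddChar.map_zsmul_eq_zpow _ _ _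

theorem zetaPow_eq_one_iff {b : ZMod N} : zetaPow b = 1 ↔ b = 0 := by
  rw [← zetaPow_zero (N := N)]
  exact ZMod.injective_stdAddChar.eq_iff

theorem summable_rowKernel {j k : ℕ} (h : j + k = 3) {a : ℝ} (ha : 1 ≤ |a|) (x : ℝ) :
    Summable fun n : ℤ => rowKernel j k a (x + n) :=
  Summable.of_norm_bounded (sum_inv_sq_add_sq x ha).1 fun _ => norm_rowKernel_le h ha _

/-- The character `n ↦ ζ_N^{-nc}` is trivial exactly when `c = 0`; only then does the integral of
the kernel survive. The constant is uniform in `a` and `x`, so the rows can be added up. -/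
theorem norm_row_sub_le {j k : ℕ} (h : j + k = 3) {κ : ℂ} (hk : IsRowKernel (rowKernel j k) κ)
    (c : ZMod N) : ∃ C : ℝ, 0 ≤ C ∧ ∀ a : ℝ, 1 ≤ |a| → ∀ x : ℝ,
      ‖∑' n : ℤ, zetaPow (-((n : ZMod N) * c)) * rowKernel j k a (x + n)
        - (if c = 0 then κ * ((a / |a| ^ 3 : ℝ) : ℂ) else 0)‖ ≤ C / |a| ^ 3 := by
  by_cases hc : c = 0
  · refine ⟨270, by norm_num, fun a ha x => ?_⟩
    obtain ⟨F, f', Lp, Lm, h1, h2, h3, h4, h5, h6⟩ := hk a ha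
    simp only [hc, mul_zero, neg_zero, zetaPow_zero, one_mul, if_true]
    rw [← h6]
    exact norm_tsum_sub_integral_le ha h1 h2 h3 x (summable_rowKernel h ha x) h4 h5
  · refine ⟨270 / ‖1 - zetaPow (-c)‖, by positivity, fun a ha x => ?_⟩
    obtain ⟨F, f', Lp, Lm, h1, h2, h3, h4, h5, h6⟩ := hk a ha
    simp only [hc, if_false, sub_zero]
    simp_rw [← mul_neg, zetaPow_intCast_mul]
    exact norm_tsum_twisted_le ha h2 h3 x (summable_rowKernel h ha x) (norm_zetaPow _)
      (by rw [ne_eq, zetaPow_eq_one_iff, neg_eq_zero]; exact hc)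

end

/-! ### Eisenstein series near the cusp -/

section

variable {N : ℕ} [NeZero N]

/-- The general term of `eisSeries`. -/
def eisTerm (j k : ℕ) (w : Fin 2 → ZMod N) (τ : ℂ) (x : ℤ × ℤ) : ℂ :=
  zetaPow ((x.1 : ZMod N) * w 1 - (x.2 : ZMod N) * w 0)
    / (((x.1 : ℂ) * τ + x.2) ^ j * ((x.1 : ℂ) * starRingEnd ℂ τ + x.2) ^ k)

theorem eisSeries_eq_tsum {j k : ℕ} (h : j + k = 3) (w : Fin 2 → ZMod N) (τ : ℂ) :
    eisSeries j k w τ = ∑' x : ℤ × ℤ, eisTerm j k w τ x := by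
  -- The term at `(0, 0)` has denominator `0`, hence the value `0` in Lean, and may be included.
  refine tsum_subtype_eq_of_support_subset (f := eisTerm j k w τ) (s := {x | x ≠ 0}) ?_
  intro x hx h0
  subst h0
  refine hx ?_
  have : j ≠ 0 ∨ k ≠ 0 := by lia
  rcases this with h | h <;> simp [eisTerm, h]

theorem norm_eisTerm {j k : ℕ} (h : j + k = 3) (w : Fin 2 → ZMod N) (τ : ℂ) (x : ℤ × ℤ) :
    ‖eisTerm j k w τ x‖ = 1 / ‖(x.1 : ℂ) * τ + x.2‖ ^ 3 := by
  have : ‖(x.1 : ℂ) * starRingEnd ℂ τ + x.2‖ = ‖(x.1 : ℂ) * τ + x.2‖ := by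
    rw [← Complex.norm_conj]; simp
  rw [eisTerm, norm_div, norm_mul, norm_pow, norm_pow, this, norm_zetaPow, ← pow_add, h]

theorem summable_eisTerm {j k : ℕ} (h : j + k = 3) (w : Fin 2 → ZMod N) {τ : ℂ} (hτ : 0 < τ.im) :
    Summable (eisTerm j k w τ) := by
  have h1 := (EisensteinSeries.summable_one_div_norm_rpow (k := 3) (by norm_num)).mul_left
    (EisensteinSeries.r ⟨τ, hτ⟩ ^ (-3 : ℝ))
  rw [← (finTwoArrowEquiv ℤ).symm.summable_iff] at h1
  refine Summable.of_norm_bounded h1 fun x => ?_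
  have h2 := EisensteinSeries.summand_bound ⟨τ, hτ⟩ (k := 3) (by norm_num) ![x.1, x.2]
  rw [norm_eisTerm h]
  refine le_trans (le_of_eq ?_) h2
  simp only [Matrix.cons_val_zero, Matrix.cons_val_one]
  rw [Real.rpow_neg (norm_nonneg _), one_div]
  norm_cast

theorem eisTerm_eq (j k : ℕ) (w : Fin 2 → ZMod N) (τ : ℂ) (m n : ℤ) :
    eisTerm j k w τ (m, n) = zetaPow ((m : ZMod N) * w 1) *
      (zetaPow (-((n : ZMod N) * w 0)) * rowKernel j k (m * τ.im) (m * τ.re + n)) := by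
  have h1 : ((m * τ.re + n : ℝ) : ℂ) + ((m * τ.im : ℝ) : ℂ) * Complex.I = m * τ + n := by
    conv_rhs => rw [← Complex.re_add_im τ]
    push_cast; ring
  have h2 : ((m * τ.re + n : ℝ) : ℂ) - ((m * τ.im : ℝ) : ℂ) * Complex.I
      = m * starRingEnd ℂ τ + n := by
    rw [show starRingEnd ℂ τ = τ.re - τ.im * Complex.I from by
      apply Complex.ext <;> simp]
    push_cast; ring
  rw [rowKernel, h1, h2, eisTerm, ← mul_assoc, ← zetaPow_add, ← sub_eq_add_neg, mul_one_div]

theorem zetaPow_mul_eq_exp (n : ℤ) (b : ZMod N) :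
    zetaPow ((n : ZMod N) * b) = Complex.exp (2 * Real.pi * Complex.I * (frac b : ℝ) * n) := by
  rw [zetaPow_intCast_mul]
  have : zetaPow b = Complex.exp (2 * Real.pi * Complex.I * b.val / N) := by
    have := ZMod.stdAddChar_coe (N := N) (b.val : ℤ)
    rw [zetaPow]
    simpa using this
  rw [this, ← Complex.exp_int_mul, frac]
  congr 1
  push_cast
  ring

theorem frac_mem_Icc (b : ZMod N) : frac b ∈ Set.Icc (0 : ℝ) 1 := by
  have hN : (0 : ℝ) < N := by exact_mod_cast Nat.pos_of_ne_zero (NeZero.ne N)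
  refine ⟨by unfold frac; positivity, ?_⟩
  rw [frac, div_le_one hN]
  exact_mod_cast (ZMod.val_lt b).le

/-- For `a = 0` the kernel is `n⁻³`, so this is the Fourier expansion of `B₃` after `n ↦ -n`, which
costs a sign. -/
theorem tsum_row_zero {j k : ℕ} (h : j + k = 3) (c : ZMod N) :
    ∑' n : ℤ, zetaPow (-((n : ZMod N) * c)) * rowKernel j k 0 n
      = -(4 * Real.pi ^ 3 * Complex.I / 3) * (bernoulliFun 3 (frac c) : ℝ) := by
  have h1 := hasSum_one_div_pow_mul_fourier_mul_bernoulliFun (k := 3) (by norm_num)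
    (frac_mem_Icc c)
  have h2 := (Equiv.neg ℤ).hasSum_iff.2 h1
  have h3 := h2.neg
  have h4 : ∀ n : ℤ, zetaPow (-((n : ZMod N) * c)) * rowKernel j k 0 n
      = -(((fun n : ℤ => 1 / (n : ℂ) ^ 3 * fourier n (frac c : AddCircle (1 : ℝ)))
        ∘ (Equiv.neg ℤ)) n) := fun n => by
    have : -((n : ZMod N) * c) = ((-n : ℤ) : ZMod N) * c := by push_cast; ring
    rw [this, zetaPow_mul_eq_exp]
    simp only [Function.comp, Equiv.neg_apply, fourier_coe_apply, rowKernel]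
    push_cast
    rw [zero_mul, add_zero, sub_zero, ← pow_add, h, Odd.neg_pow (by decide)]
    ring_nf
  simp_rw [h4]
  rw [h3.tsum_eq]
  have hI : (2 * Real.pi * Complex.I : ℂ) ^ 3 = -(8 * Real.pi ^ 3 * Complex.I) := by
    rw [mul_pow, Complex.I_pow_three]; ring
  rw [hI]
  rw [show Nat.factorial 3 = 6 from rfl]
  push_cast
  ring

/-- The factor `m / |m|³` is `sgn(m) / m²`: positive and negative `m` contribute one value of `ζ̂`
each, with opposite signs. -/
theorem hasSum_zetaPow_mul_div (d : ZMod N) :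
    HasSum (fun m : ℤ => zetaPow ((m : ZMod N) * d) * ((m / |(m : ℝ)| ^ 3 : ℝ) : ℂ))
      (zetaHat d 2 - zetaHat (-d) 2) := by
  have hz : ∀ b : ZMod N, HasSum (fun n : ℕ => zetaPow ((n : ZMod N) * b) * (1 / (n : ℂ) ^ 2))
      (zetaHat b 2) := fun b => by
    have h := HurwitzZeta.hasSum_expZeta_of_one_lt_re (frac b) (s := 2) (by norm_num)
    rw [frac, ← ZMod.toAddCircle_apply] at h
    convert! h using 2 with n
    have := zetaPow_mul_eq_exp (n : ℤ) b
    push_cast at this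
    rw [this, frac, mul_one_div]
    push_cast
    norm_cast
  have hn : ∀ n : ℕ, ((n / |(n : ℝ)| ^ 3 : ℝ) : ℂ) = 1 / (n : ℂ) ^ 2 := fun n => by
    rw [Nat.abs_cast]
    rcases eq_or_ne n 0 with rfl | h
    · simp
    · have : (n : ℂ) ≠ 0 := by exact_mod_cast h
      push_cast
      field_simp
  have h := HasSum.of_nat_of_neg
    (f := fun m : ℤ => zetaPow ((m : ZMod N) * d) * ((m / |(m : ℝ)| ^ 3 : ℝ) : ℂ))
    (g := zetaHat d 2) (g' := -zetaHat (-d) 2) ?_ ?_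
  · simpa [sub_eq_add_neg] using h
  · convert! hz d using 2 with n
    push_cast
    rw [← hn]; push_cast; rfl
  · convert! (hz (-d)).neg using 2 with n
    rw [← hn]
    push_cast
    rw [abs_neg]
    ring_nf

theorem norm_eisSeries_sub_le {j k : ℕ} (h : j + k = 3) {κ : ℂ}
    (hk : IsRowKernel (rowKernel j k) κ) (w : Fin 2 → ZMod N) : ∃ C : ℝ, ∀ τ : ℂ, 1 ≤ τ.im →
      ‖eisSeries j k w τ - (-(4 * Real.pi ^ 3 * Complex.I / 3) * (bernoulliFun 3 (frac (w 0)) : ℝ)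
        + (if w 0 = 0 then κ * (zetaHat (w 1) 2 - zetaHat (-w 1) 2) else 0) / (τ.im : ℂ) ^ 2)‖
      ≤ C / τ.im ^ 3 := by
  obtain ⟨C, hC, hrow⟩ := norm_row_sub_le h hk (w 0)
  refine ⟨∑' m : ℤ, C * (1 / |(m : ℝ)| ^ 3), fun τ hτ => ?_⟩
  have hY : 0 < τ.im := by linarith
  have hs3 : Summable fun m : ℤ => 1 / |(m : ℝ)| ^ 3 := by
    simpa [abs_pow] using (Real.summable_one_div_int_pow.2 (by norm_num : 1 < 3)).abs
  have hsum := summable_eisTerm h w hY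
  set H : ℤ → ℂ := fun m => ∑' n : ℤ, eisTerm j k w τ (m, n) with hH
  have hHs : Summable H := hsum.prod
  have hH0 : H 0 = -(4 * Real.pi ^ 3 * Complex.I / 3) * (bernoulliFun 3 (frac (w 0)) : ℝ) := by
    rw [hH, ← tsum_row_zero h]
    refine tsum_congr fun n => ?_
    rw [eisTerm_eq]
    simp [zetaPow_zero]
  -- `H m` is the exact row sum and `M m` its main term for `m ≠ 0`; `M 0 = 0` in Lean, so the row
  -- `m = 0` is subtracted separately.
  set M : ℤ → ℂ := fun m => (if w 0 = 0 then κ else 0) / (τ.im : ℂ) ^ 2 *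
    (zetaPow ((m : ZMod N) * w 1) * ((m / |(m : ℝ)| ^ 3 : ℝ) : ℂ)) with hM
  have hMs : HasSum M ((if w 0 = 0 then κ else 0) / (τ.im : ℂ) ^ 2 *
    (zetaHat (w 1) 2 - zetaHat (-w 1) 2)) := (hasSum_zetaPow_mul_div (w 1)).mul_left _
  have hH1 : HasSum (fun m : ℤ => if m = 0 then H 0 else 0) (H 0) := by
    simpa using hasSum_ite_eq (0 : ℤ) (H 0)
  have key : ∀ m : ℤ, ‖H m - (if m = 0 then H 0 else 0) - M m‖
      ≤ C * (1 / |(m : ℝ)| ^ 3) * (1 / τ.im ^ 3) := fun m => by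
    rcases eq_or_ne m 0 with rfl | hm
    · simp [hM]
    · have hm1 : (1 : ℝ) ≤ |(m : ℝ)| := by exact_mod_cast Int.one_le_abs hm
      have ha : 1 ≤ |m * τ.im| := by
        rw [abs_mul, abs_of_pos hY]; nlinarith
      have h1 := hrow (m * τ.im) ha (m * τ.re)
      have h2 : H m = zetaPow ((m : ZMod N) * w 1) *
          ∑' n : ℤ, zetaPow (-((n : ZMod N) * w 0)) * rowKernel j k (m * τ.im) (m * τ.re + n) := by
        rw [← tsum_mul_left]
        exact tsum_congr fun n => eisTerm_eq j k w τ m n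
      have h3 : M m = zetaPow ((m : ZMod N) * w 1) *
          (if w 0 = 0 then κ * ((m * τ.im / |m * τ.im| ^ 3 : ℝ) : ℂ) else 0) := by
        have hYc : (τ.im : ℂ) ≠ 0 := by exact_mod_cast hY.ne'
        have hmc : ((|(m : ℝ)| : ℝ) : ℂ) ≠ 0 := by
          exact_mod_cast (by linarith : |(m : ℝ)| ≠ 0)
        simp only [hM]
        split_ifs
        · rw [abs_mul, abs_of_pos hY]
          push_cast
          field_simp
        · simp
      rw [if_neg hm, sub_zero, h2, h3, ← mul_sub, norm_mul, norm_zetaPow, one_mul]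
      refine h1.trans (le_of_eq ?_)
      rw [abs_mul, abs_of_pos hY, mul_pow]
      field_simp
  have htot : HasSum (fun m => H m - (if m = 0 then H 0 else 0) - M m) _ :=
    (hHs.hasSum.sub hH1).sub hMs
  have hE : eisSeries j k w τ = ∑' m, H m := by
    rw [eisSeries_eq_tsum h, hsum.tsum_prod]
  have hbd := tsum_of_norm_bounded ((hs3.mul_left C).mul_right (1 / τ.im ^ 3)).hasSum key
  rw [htot.tsum_eq, tsum_mul_right, mul_one_div, ← hE, hH0] at hbd
  refine le_trans (le_of_eq ?_) hbd
  congr 1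
  split_ifs <;> ring

end

/-! ### Behaviour as the imaginary part tends to infinity -/

/-- The filter `Im τ → ∞` on the complex numbers. -/
def imInfty : Filter ℂ := comap Complex.im atTop

theorem tendsto_im_imInfty : Tendsto Complex.im imInfty atTop := tendsto_comap

theorem eventually_imInfty_of_lt (c : ℝ) : ∀ᶠ τ in imInfty, c < τ.im :=
  tendsto_im_imInfty.eventually_gt_atTop c

theorem tendsto_one_div_im_pow : Tendsto (fun τ : ℂ => 1 / τ.im ^ 3) imInfty (𝓝 0) := by
  simp_rw [one_div]
  exact tendsto_inv_atTop_zero.comp ((tendsto_pow_atTop (by norm_num)).comp tendsto_im_imInfty)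

theorem eventually_imInfty {p : ℂ → Prop} :
    (∀ᶠ τ in imInfty, p τ) ↔ ∃ c : ℝ, ∀ τ : ℂ, c ≤ τ.im → p τ := by
  rw [imInfty, eventually_comap, eventually_atTop]
  exact exists_congr fun c => ⟨fun h τ hτ => h _ hτ τ rfl, fun h b hb a hab => h a (hab ▸ hb)⟩

/-- The `q`-products converge exponentially fast, but the Eisenstein series are known only up to
`Y⁻³`, so all errors are measured on that scale. -/
theorem isBigO_exp_neg_im {x : ℝ} (hx : 0 < x) :
    (fun τ : ℂ => Real.exp (-x * τ.im)) =O[imInfty] fun τ => 1 / τ.im ^ 3 := by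
  have h := ((isLittleO_exp_neg_mul_rpow_atTop hx (-3)).isBigO.comp_tendsto tendsto_im_imInfty)
  refine h.congr' EventuallyEq.rfl ?_
  filter_upwards [eventually_imInfty_of_lt 0] with τ hτ
  simp only [Function.comp]
  rw [Real.rpow_neg hτ.le, one_div]
  norm_cast

/-! ### Infinite products in `q` and their logarithmic derivatives -/

theorem norm_tprod_one_add_sub_one_le {f : ℕ → ℂ} (hf : Summable fun n => ‖f n‖) {B : ℝ}
    (hB : ∑' n, ‖f n‖ ≤ B) : ‖∏' n, (1 + f n) - 1‖ ≤ B * Real.exp B := by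
  have h1 := (multipliable_one_add_of_summable hf).hasProd.tendsto_prod_nat
  have hB0 : 0 ≤ B := (tsum_nonneg fun n => norm_nonneg _).trans hB
  refine le_of_tendsto (h1.sub_const 1).norm (Eventually.of_forall fun n => ?_)
  refine (Finset.norm_prod_one_add_sub_one_le _ _).trans ?_
  have h2 : ∑ i ∈ Finset.range n, ‖f i‖ ≤ B :=
    (hf.sum_le_tsum _ fun _ _ => norm_nonneg _).trans hB
  have h3 : Real.exp (∑ i ∈ Finset.range n, ‖f i‖) ≤ Real.exp B := Real.exp_le_exp.2 h2
  -- Multiplying `1 - B ≤ e^{-B}` by `e^B` gives `e^B - 1 ≤ B e^B`.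
  have h4 := Real.add_one_le_exp (-B)
  have h5 : Real.exp (-B) * Real.exp B = 1 := by rw [← Real.exp_add]; simp
  nlinarith [Real.exp_pos B]

/-- The infinite product `∏_{n ≥ 0} (1 - q^{n + x} ζ)`. -/
def qProd (x : ℝ) (ζ τ : ℂ) : ℂ :=
  ∏' n : ℕ, (1 - Complex.exp (2 * Real.pi * Complex.I * ((n + x : ℝ) : ℂ) * τ) * ζ)

theorem norm_qTerm (x : ℝ) {ζ : ℂ} (hζ : ‖ζ‖ = 1) (τ : ℂ) (n : ℕ) :
    ‖-(Complex.exp (2 * Real.pi * Complex.I * ((n + x : ℝ) : ℂ) * τ) * ζ)‖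
      = Real.exp (-(2 * Real.pi * x) * τ.im) * Real.exp (-(2 * Real.pi) * τ.im) ^ n := by
  rw [norm_neg, norm_mul, hζ, mul_one, Complex.norm_exp, ← Real.exp_nat_mul, ← Real.exp_add]
  congr 1
  have : (2 * Real.pi * Complex.I * ((n + x : ℝ) : ℂ) * τ)
      = ((2 * Real.pi * (n + x) : ℝ) : ℂ) * (Complex.I * τ) := by push_cast; ring
  rw [this, Complex.re_ofReal_mul]
  simp
  ring

theorem norm_qTerm_le (x : ℝ) {ζ : ℂ} (hζ : ‖ζ‖ = 1) {τ : ℂ} (hτ : 1 ≤ τ.im) (n : ℕ) :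
    ‖-(Complex.exp (2 * Real.pi * Complex.I * ((n + x : ℝ) : ℂ) * τ) * ζ)‖
      ≤ Real.exp (-(2 * Real.pi * x) * τ.im) * (1 / 2) ^ n := by
  rw [norm_qTerm x hζ]
  have h1 : Real.exp (-(2 * Real.pi) * τ.im) ≤ Real.exp (-1) :=
    Real.exp_le_exp.2 (by nlinarith [Real.pi_gt_three])
  have h2 : Real.exp (-1) ≤ 1 / 2 := by
    rw [Real.exp_neg, inv_eq_one_div]
    exact one_div_le_one_div_of_le (by norm_num) (by linarith [Real.add_one_le_exp (1 : ℝ)])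
  gcongr
  exact h1.trans h2

theorem summable_qTerm (x : ℝ) {ζ : ℂ} (hζ : ‖ζ‖ = 1) {τ : ℂ} (hτ : 1 ≤ τ.im) :
    Summable fun n : ℕ =>
      ‖-(Complex.exp (2 * Real.pi * Complex.I * ((n + x : ℝ) : ℂ) * τ) * ζ)‖ :=
  Summable.of_nonneg_of_le (fun _ => norm_nonneg _) (norm_qTerm_le x hζ hτ)
    (summable_geometric_two.mul_left _)

theorem qProd_sub_one_isBigO {x : ℝ} (hx : 0 < x) {ζ : ℂ} (hζ : ‖ζ‖ = 1) :
    (fun τ => qProd x ζ τ - 1) =O[imInfty] fun τ => 1 / τ.im ^ 3 := by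
  refine Asymptotics.IsBigO.trans ?_ (isBigO_exp_neg_im (x := 2 * Real.pi * x) (by positivity))
  refine Asymptotics.IsBigO.of_bound (2 * Real.exp 2) ?_
  filter_upwards [eventually_imInfty_of_lt 1] with τ hτ
  set e := Real.exp (-(2 * Real.pi * x) * τ.im) with he
  have he1 : e ≤ 1 := Real.exp_le_one_iff.2 (by
    have : 0 < 2 * Real.pi * x * τ.im := by positivity
    linarith)
  have hs := summable_qTerm x hζ hτ.le
  have hB : ∑' n : ℕ, ‖-(Complex.exp (2 * Real.pi * Complex.I * ((n + x : ℝ) : ℂ) * τ) * ζ)‖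
      ≤ 2 * e := by
    refine (hs.tsum_le_tsum (norm_qTerm_le x hζ hτ.le) (summable_geometric_two.mul_left _)).trans ?_
    rw [tsum_mul_left, tsum_geometric_two, mul_comm]
  have h := norm_tprod_one_add_sub_one_le hs hB
  simp only [← sub_eq_add_neg] at h
  refine h.trans ?_
  have h0 : 0 < e := Real.exp_pos _
  have : Real.exp (2 * e) ≤ Real.exp 2 := Real.exp_le_exp.2 (by linarith)
  rw [Real.norm_of_nonneg h0.le]
  nlinarith

theorem isOpen_one_lt_im : IsOpen {τ : ℂ | 1 < τ.im} :=
  isOpen_lt continuous_const Complex.continuous_im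

/-- For `Im τ > 1` the terms are dominated by `2⁻ⁿ`, so the product converges locally uniformly. -/
theorem differentiableOn_qProd {x : ℝ} (hx : 0 < x) {ζ : ℂ} (hζ : ‖ζ‖ = 1) :
    DifferentiableOn ℂ (qProd x ζ) {τ : ℂ | 1 < τ.im} := by
  have h := summable_geometric_two.hasProdLocallyUniformlyOn_nat_one_add (R := ℂ)
    (f := fun n τ => -(Complex.exp (2 * Real.pi * Complex.I * ((n + x : ℝ) : ℂ) * τ) * ζ))
    isOpen_one_lt_im (Eventually.of_forall fun n τ hτ => by
      refine (norm_qTerm_le x hζ (le_of_lt hτ) n).trans ?_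
      refine mul_le_of_le_one_left (by positivity) (Real.exp_le_one_iff.2 ?_)
      have h1 : (1 : ℝ) < τ.im := hτ
      have : 0 < 2 * Real.pi * x * τ.im := by positivity
      linarith) (fun n => by fun_prop)
  simp only [← sub_eq_add_neg] at h
  exact h.differentiableOn (Eventually.of_forall fun s => by
    simpa [Finset.prod_fn] using DifferentiableOn.finsetProd (fun _ _ => by fun_prop))
    isOpen_one_lt_im

/-- Logarithm and logarithmic derivative of a function that tends to a nonzero constant. -/
theorem log_norm_sub_isBigO {P : ℂ → ℂ} {c : ℂ} (hc : c ≠ 0)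
    (h : (fun τ => P τ - c) =O[imInfty] fun τ => 1 / τ.im ^ 3) :
    (fun τ => Real.log ‖P τ‖ - Real.log ‖c‖) =O[imInfty] fun τ => 1 / τ.im ^ 3 := by
  have ht : Tendsto P imInfty (𝓝 c) := tendsto_sub_nhds_zero_iff.1 (h.trans_tendsto tendsto_one_div_im_pow)
  have hl := ((Real.hasDerivAt_log (norm_ne_zero_iff.2 hc)).isBigO_sub).comp_tendsto ht.norm
  refine hl.trans (Asymptotics.IsBigO.trans ?_ h)
  refine Asymptotics.IsBigO.of_bound 1 (Eventually.of_forall fun τ => ?_)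
  rw [one_mul, Real.norm_eq_abs]
  exact abs_norm_sub_norm_le _ _

/-- Cauchy's estimate for `P - c` on the unit disc around `τ` bounds the derivative. There the
height is at least `Im τ / 2`, which explains the factor `8 = 2³`. -/
theorem logDeriv_isBigO {P : ℂ → ℂ} {c : ℂ} (hc : c ≠ 0)
    (hd : DifferentiableOn ℂ P {τ : ℂ | 1 < τ.im})
    (h : (fun τ => P τ - c) =O[imInfty] fun τ => 1 / τ.im ^ 3) :
    logDeriv P =O[imInfty] fun τ => 1 / τ.im ^ 3 := by
  have ht : Tendsto P imInfty (𝓝 c) := tendsto_sub_nhds_zero_iff.1 (h.trans_tendsto tendsto_one_div_im_pow)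
  have hinv : (fun τ => (P τ)⁻¹) =O[imInfty] fun _ => (1 : ℝ) :=
    (ht.inv₀ hc).isBigO_one ℝ
  obtain ⟨C, hC, hb⟩ := h.exists_pos
  rw [Asymptotics.isBigOWith_iff, eventually_imInfty] at hb
  obtain ⟨c0, hb⟩ := hb
  have hder : deriv P =O[imInfty] fun τ => 1 / τ.im ^ 3 := by
    refine Asymptotics.IsBigO.of_bound (8 * C) ?_
    filter_upwards [eventually_imInfty_of_lt 2, eventually_imInfty_of_lt (c0 + 1)] with τ h2 hc1
    have him : ∀ z ∈ Metric.closedBall τ 1, τ.im - 1 ≤ z.im := fun z hz => by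
      have h3 := (Complex.abs_im_le_norm (z - τ)).trans (mem_closedBall_iff_norm.1 hz)
      rw [Complex.sub_im] at h3
      linarith [(abs_le.1 h3).1]
    have hdc : DiffContOnCl ℂ (fun z => P z - c) (Metric.ball τ 1) := by
      refine DifferentiableOn.diffContOnCl ?_
      rw [closure_ball τ one_ne_zero]
      refine (hd.mono fun z hz => ?_).sub_const c
      have := him z hz
      exact show 1 < z.im by linarith
    have key := Complex.norm_deriv_le_of_forall_mem_sphere_norm_le one_pos hdc
      (C := 8 * C * (1 / τ.im ^ 3)) fun z hz => by
        have h3 := him z (Metric.sphere_subset_closedBall hz)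
        refine (hb z (by linarith)).trans ?_
        have h4 : τ.im / 2 ≤ z.im := by linarith
        have h5 : 0 < τ.im / 2 := by linarith
        rw [Real.norm_of_nonneg (by have := h5.trans_le h4; positivity)]
        calc C * (1 / z.im ^ 3) ≤ C * (1 / (τ.im / 2) ^ 3) := by gcongr
          _ = 8 * C * (1 / τ.im ^ 3) := by rw [div_pow, one_div_div]; ring
    rw [deriv_sub_const, div_one] at key
    rwa [Real.norm_of_nonneg (by have : 0 < τ.im := by linarith
                                 positivity)]
  have := hder.mul hinv
  simp only [mul_one] at this
  exact this

/-! ### Siegel units near the cusp -/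

theorem frac_zero {N : ℕ} : frac (0 : ZMod N) = 0 := by simp [frac]

section

variable {N : ℕ} [NeZero N]

/-- The product part of the Siegel unit. -/
def siegelProd (w : Fin 2 → ZMod N) (τ : ℂ) : ℂ :=
  qProd (frac (w 0)) (zetaPow (w 1)) τ * qProd (1 - frac (w 0)) (zetaPow (-(w 1))) τ

/-- The limit of `siegelProd` at the cusp. -/
def siegelConst (w : Fin 2 → ZMod N) : ℂ := if w 0 = 0 then 1 - zetaPow (w 1) else 1

theorem siegelConst_ne_zero {w : Fin 2 → ZMod N} (hw : w ≠ 0) : siegelConst w ≠ 0 := by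
  unfold siegelConst
  split_ifs with h
  · rw [sub_ne_zero, ne_comm, ne_eq, zetaPow_eq_one_iff]
    intro h1
    exact hw (funext fun i => by fin_cases i <;> simp [h, h1])
  · exact one_ne_zero

theorem siegelUnit_eq (w : Fin 2 → ZMod N) (τ : ℂ) :
    siegelUnit w τ = Complex.exp (2 * Real.pi * Complex.I *
      ((bernoulliFun 2 (frac (w 0)) / 2 : ℝ) : ℂ) * τ) * siegelProd w τ := by
  simp only [siegelUnit, siegelProd, qProd, mul_assoc, add_sub_assoc]

theorem frac_pos {a : ZMod N} (ha : a ≠ 0) : 0 < frac a := by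
  have hN : (0 : ℝ) < N := by exact_mod_cast Nat.pos_of_ne_zero (NeZero.ne N)
  have : (0 : ℝ) < a.val := by
    exact_mod_cast Nat.pos_of_ne_zero fun h => ha ((ZMod.val_eq_zero a).1 h)
  unfold frac
  positivity

theorem frac_lt_one (a : ZMod N) : frac a < 1 := by
  have hN : (0 : ℝ) < N := by exact_mod_cast Nat.pos_of_ne_zero (NeZero.ne N)
  rw [frac, div_lt_one hN]
  exact_mod_cast ZMod.val_lt a

theorem qProd_zero {ζ : ℂ} (hζ : ‖ζ‖ = 1) {τ : ℂ} (hτ : 1 < τ.im) :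
    qProd 0 ζ τ = (1 - ζ) * qProd 1 ζ τ := by
  have hs := summable_qTerm 1 hζ hτ.le
  have hm := multipliable_one_add_of_summable hs
  rw [qProd, tprod_eq_zero_mul']
  · simp [qProd]
  · simpa [← sub_eq_add_neg] using hm

/-- When `w 0 = 0` the factor `n = 0` of the first product is the constant `1 - ζ_N^b`. Once it is
split off, both products have positive exponents and tend to `1`. -/
theorem siegelProd_eq (w : Fin 2 → ZMod N) {τ : ℂ} (hτ : 1 < τ.im) :
    siegelProd w τ = siegelConst w *
      (qProd (if w 0 = 0 then 1 else frac (w 0)) (zetaPow (w 1)) τ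
        * qProd (1 - frac (w 0)) (zetaPow (-(w 1))) τ) := by
  unfold siegelProd siegelConst
  split_ifs with h
  · rw [h, frac_zero, qProd_zero (norm_zetaPow _) hτ, mul_assoc]
  · rw [one_mul]

theorem differentiableOn_siegelProd (w : Fin 2 → ZMod N) :
    DifferentiableOn ℂ (siegelProd w) {τ : ℂ | 1 < τ.im} := by
  have h1 : 0 < if w 0 = 0 then 1 else frac (w 0) := by
    split_ifs with h
    · exact one_pos
    · exact frac_pos h
  have h2 : 0 < 1 - frac (w 0) := sub_pos.2 (frac_lt_one _)
  refine DifferentiableOn.congr ?_ fun τ hτ => siegelProd_eq w hτ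
  exact ((differentiableOn_qProd h1 (norm_zetaPow _)).mul
    (differentiableOn_qProd h2 (norm_zetaPow _))).const_mul _

theorem siegelProd_sub_isBigO (w : Fin 2 → ZMod N) :
    (fun τ => siegelProd w τ - siegelConst w) =O[imInfty] fun τ => 1 / τ.im ^ 3 := by
  have h1 : 0 < if w 0 = 0 then 1 else frac (w 0) := by
    split_ifs with h
    · exact one_pos
    · exact frac_pos h
  have h2 : 0 < 1 - frac (w 0) := sub_pos.2 (frac_lt_one _)
  have hA := qProd_sub_one_isBigO h1 (norm_zetaPow (w 1))
  have hB := qProd_sub_one_isBigO h2 (norm_zetaPow (-(w 1)))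
  have hB1 := (tendsto_sub_nhds_zero_iff.1 (hB.trans_tendsto tendsto_one_div_im_pow)).isBigO_one ℝ
  have hAB := (hA.mul hB1).add (hB.congr_right fun τ => (mul_one _).symm)
  refine ((hAB.const_mul_left (siegelConst w)).congr' ?_ ?_)
  · filter_upwards [eventually_imInfty_of_lt 1] with τ hτ
    rw [siegelProd_eq w hτ]
    ring
  · exact Eventually.of_forall fun τ => mul_one _

theorem log_norm_siegelUnit_isBigO {w : Fin 2 → ZMod N} (hw : w ≠ 0) :
    (fun τ => Real.log ‖siegelUnit w τ‖ - (-(Real.pi * bernoulliFun 2 (frac (w 0)) * τ.im)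
      + Real.log ‖siegelConst w‖)) =O[imInfty] fun τ => 1 / τ.im ^ 3 := by
  have hc := siegelConst_ne_zero hw
  have hO := siegelProd_sub_isBigO w
  have hne := (tendsto_sub_nhds_zero_iff.1 (hO.trans_tendsto tendsto_one_div_im_pow)).eventually_ne hc
  refine (log_norm_sub_isBigO hc hO).congr' ?_ EventuallyEq.rfl
  filter_upwards [hne] with τ hτ
  rw [siegelUnit_eq, norm_mul, Real.log_mul (by simp) (norm_ne_zero_iff.2 hτ), Complex.norm_exp,
    Real.log_exp]
  have : (2 * Real.pi * Complex.I * ((bernoulliFun 2 (frac (w 0)) / 2 : ℝ) : ℂ) * τ).re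
      = -(Real.pi * bernoulliFun 2 (frac (w 0)) * τ.im) := by
    rw [show 2 * Real.pi * Complex.I * ((bernoulliFun 2 (frac (w 0)) / 2 : ℝ) : ℂ) * τ
      = ((Real.pi * bernoulliFun 2 (frac (w 0)) : ℝ) : ℂ) * (Complex.I * τ) by push_cast; ring,
      Complex.re_ofReal_mul]
    simp
  rw [this]
  ring

theorem differentiableOn_siegelUnit (w : Fin 2 → ZMod N) :
    DifferentiableOn ℂ (siegelUnit w) {τ : ℂ | 1 < τ.im} := by
  refine DifferentiableOn.congr ?_ fun τ _ => siegelUnit_eq w τ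
  exact DifferentiableOn.mul (by fun_prop) (differentiableOn_siegelProd w)

theorem logDeriv_siegelUnit_isBigO {w : Fin 2 → ZMod N} (hw : w ≠ 0) :
    (fun τ => logDeriv (siegelUnit w) τ - Real.pi * Complex.I * (bernoulliFun 2 (frac (w 0)) : ℝ))
      =O[imInfty] fun τ => 1 / τ.im ^ 3 := by
  have hc := siegelConst_ne_zero hw
  have hO := siegelProd_sub_isBigO w
  have hne := (tendsto_sub_nhds_zero_iff.1 (hO.trans_tendsto tendsto_one_div_im_pow)).eventually_ne hc
  refine (logDeriv_isBigO hc (differentiableOn_siegelProd w) hO).congr' ?_ EventuallyEq.rfl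
  filter_upwards [hne, eventually_imInfty_of_lt 1] with τ hτ h1
  rw [show siegelUnit w = fun τ => Complex.exp (2 * Real.pi * Complex.I *
      ((bernoulliFun 2 (frac (w 0)) / 2 : ℝ) : ℂ) * τ) * siegelProd w τ from
      funext (siegelUnit_eq w),
    logDeriv_mul (f := fun τ => Complex.exp (2 * Real.pi * Complex.I *
      ((bernoulliFun 2 (frac (w 0)) / 2 : ℝ) : ℂ) * τ)) τ (Complex.exp_ne_zero _) hτ (by fun_prop)
      ((differentiableOn_siegelProd w).differentiableAt (isOpen_one_lt_im.mem_nhds h1))]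
  have : logDeriv (fun τ => Complex.exp (2 * Real.pi * Complex.I *
      ((bernoulliFun 2 (frac (w 0)) / 2 : ℝ) : ℂ) * τ)) τ
      = Real.pi * Complex.I * (bernoulliFun 2 (frac (w 0)) : ℝ) := by
    rw [logDeriv_apply]
    have h := ((hasDerivAt_id τ).const_mul (2 * Real.pi * Complex.I *
      ((bernoulliFun 2 (frac (w 0)) / 2 : ℝ) : ℂ))).cexp
    simp only [id] at h
    rw [h.deriv, mul_div_cancel_left₀ _ (Complex.exp_ne_zero _)]
    push_cast
    ring
  rw [this]
  ring

theorem eisSeries_sub_isBigO {j k : ℕ} (h : j + k = 3) {κ : ℂ}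
    (hk : IsRowKernel (rowKernel j k) κ) (w : Fin 2 → ZMod N) :
    (fun τ => eisSeries j k w τ
      - (-(4 * Real.pi ^ 3 * Complex.I / 3) * (bernoulliFun 3 (frac (w 0)) : ℝ)
        + (if w 0 = 0 then κ * (zetaHat (w 1) 2 - zetaHat (-w 1) 2) else 0) / (τ.im : ℂ) ^ 2))
      =O[imInfty] fun τ => 1 / τ.im ^ 3 := by
  obtain ⟨C, hC⟩ := norm_eisSeries_sub_le h hk w
  refine Asymptotics.IsBigO.of_bound C ?_
  filter_upwards [eventually_imInfty_of_lt 1] with τ hτ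
  refine (hC τ hτ.le).trans (le_of_eq ?_)
  rw [Real.norm_of_nonneg (by have : 0 < τ.im := by linarith
                              positivity), mul_one_div]

end

/-! ### The geodesic from `iy` to `α + iy` -/

/-- The geodesic from `iy` to `α + iy`. -/
def cuspPath (α y s : ℝ) : ℂ :=
  y * Complex.I + s * α * (2 * y * Complex.I) / (α * (1 - s) + 2 * y * Complex.I)

/-- The velocity of `cuspPath`. -/
def cuspPathDeriv (α y s : ℝ) : ℂ :=
  2 * y * Complex.I * α * (α + 2 * y * Complex.I) / (α * (1 - s) + 2 * y * Complex.I) ^ 2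

theorem cuspPath_denom_ne_zero (α s : ℝ) {y : ℝ} (hy : 0 < y) :
    (α : ℂ) * (1 - s) + 2 * y * Complex.I ≠ 0 := fun h => hy.ne' (by
  simpa using congrArg Complex.im h)

theorem geodesic_eq_cuspPath (α s : ℝ) {y : ℝ} (hy : 0 < y) :
    geodesic (y * Complex.I) (α + y * Complex.I) s = cuspPath α y s := by
  have h0 := cuspPath_denom_ne_zero α s hy
  have h1 : (α : ℂ) + 2 * y * Complex.I ≠ 0 := by simpa using cuspPath_denom_ne_zero α 0 hy
  have h2 : (α : ℂ) + y * Complex.I - -(y * Complex.I) = α + 2 * y * Complex.I := by ring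
  have h3 : (1 : ℂ) - s * (α / (α + 2 * y * Complex.I))
      = (α * (1 - s) + 2 * y * Complex.I) / (α + 2 * y * Complex.I) := by
    field_simp; ring
  have hw : ((α : ℂ) + y * Complex.I - y * Complex.I) = α := by ring
  simp only [geodesic, cuspPath, map_mul, Complex.conj_ofReal, Complex.conj_I, mul_neg]
  rw [h2, hw, h3, div_div_eq_mul_div, div_eq_iff h0, add_mul, div_mul_cancel₀ _ h0]
  have h4 : (s : ℂ) * (α / (α + 2 * y * Complex.I)) * (α + 2 * y * Complex.I) = s * α := by
    rw [mul_assoc, div_mul_cancel₀ _ h1]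
  linear_combination (y * Complex.I) * h4

theorem hasDerivAt_cuspPath (α s : ℝ) {y : ℝ} (hy : 0 < y) :
    HasDerivAt (cuspPath α y) (cuspPathDeriv α y s) s := by
  have h0 := cuspPath_denom_ne_zero α s hy
  have hs : HasDerivAt (fun s : ℝ => (s : ℂ)) 1 s := by
    simpa using hasDerivAt_ofReal_add s 0
  have hn := (hs.mul_const (α : ℂ)).mul_const (2 * y * Complex.I)
  have hd := ((hs.const_sub 1).const_mul (α : ℂ)).add_const (2 * y * Complex.I)
  have h := (hn.div hd h0).const_add (y * Complex.I)
  convert! h using 1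
  rw [cuspPathDeriv]
  congr 1
  ring

theorem continuous_cuspPath (α : ℝ) {y : ℝ} (hy : 0 < y) : Continuous (cuspPath α y) :=
  continuous_iff_continuousAt.2 fun s => (hasDerivAt_cuspPath α s hy).continuousAt

theorem continuous_cuspPathDeriv (α : ℝ) {y : ℝ} (hy : 0 < y) :
    Continuous (cuspPathDeriv α y) := by
  unfold cuspPathDeriv
  exact Continuous.div (by fun_prop) (by fun_prop)
    fun s => pow_ne_zero 2 (cuspPath_denom_ne_zero α s hy)

theorem cuspPath_zero (α y : ℝ) : cuspPath α y 0 = y * Complex.I := by simp [cuspPath]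

theorem cuspPath_one (α : ℝ) {y : ℝ} (hy : 0 < y) :
    cuspPath α y 1 = α + y * Complex.I := by
  have : (2 * y * Complex.I : ℂ) ≠ 0 := by simpa using cuspPath_denom_ne_zero 0 1 hy
  simp only [cuspPath, Complex.ofReal_one, sub_self, mul_zero, zero_add, one_mul]
  rw [mul_div_cancel_right₀ _ this, add_comm]

theorem le_norm_cuspPath_denom (α s y : ℝ) :
    2 * y ≤ ‖(α : ℂ) * (1 - s) + 2 * y * Complex.I‖ := by
  have h := Complex.abs_im_le_norm ((α : ℂ) * (1 - s) + 2 * y * Complex.I)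
  have : ((α : ℂ) * (1 - s) + 2 * y * Complex.I).im = 2 * y := by simp
  rw [this] at h
  exact (le_abs_self _).trans h

theorem norm_cuspPath_le {α y s : ℝ} (hy : 0 < y) (hs : s ∈ Set.Icc (0 : ℝ) 1) :
    ‖cuspPath α y s‖ ≤ y + |α| := by
  have h := le_norm_cuspPath_denom α s y
  refine (norm_add_le _ _).trans (add_le_add (by simp [abs_of_pos hy]) ?_)
  rw [norm_div, div_le_iff₀ (by linarith)]
  have : ‖(s : ℂ) * α * (2 * y * Complex.I)‖ = s * |α| * (2 * y) := by
    simp [abs_of_pos hy, abs_of_nonneg hs.1]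
  rw [this]
  have := hs.2
  have := hs.1
  have := abs_nonneg α
  calc s * |α| * (2 * y) ≤ 1 * |α| * (2 * y) := by gcongr
    _ ≤ _ := by rw [one_mul]; gcongr

/-- The geodesic arc rises above its endpoints, so `Im τ → ∞` uniformly in `s`. -/
theorem le_im_cuspPath {α y s : ℝ} (hy : 0 < y) (hs : s ∈ Set.Icc (0 : ℝ) 1) :
    y ≤ (cuspPath α y s).im := by
  have h0 := cuspPath_denom_ne_zero α s hy
  have hnum : ((s : ℂ) * α * (2 * y * Complex.I)) = ((s * α * (2 * y) : ℝ) : ℂ) * Complex.I := by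
    push_cast; ring
  rw [cuspPath, hnum, Complex.add_im, Complex.div_im]
  simp
  have := hs.2
  have := hs.1
  refine div_nonneg ?_ (Complex.normSq_nonneg _)
  have : 0 ≤ s * (1 - s) * (α * α) * (2 * y) := by
    have : 0 ≤ 1 - s := by linarith
    have := mul_self_nonneg α
    positivity
  linarith

theorem norm_cuspPathDeriv_le {α y s : ℝ} (hy : 0 < y) (hα : |α| ≤ y) :
    ‖cuspPathDeriv α y s‖ ≤ 2 * |α| := by
  have h := le_norm_cuspPath_denom α s y
  have h1 : ‖(α : ℂ) + 2 * y * Complex.I‖ ≤ 3 * y := by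
    refine (norm_add_le _ _).trans ?_
    simp [abs_of_pos hy]
    linarith
  rw [cuspPathDeriv, norm_div, norm_pow, div_le_iff₀ (pow_pos (by linarith) 2), norm_mul]
  have h2 : ‖(2 * y * Complex.I * α : ℂ)‖ = 2 * y * |α| := by simp [abs_of_pos hy]
  rw [h2]
  have := abs_nonneg α
  calc 2 * y * |α| * ‖(α : ℂ) + 2 * y * Complex.I‖ ≤ 2 * y * |α| * (3 * y) := by gcongr
    _ ≤ 2 * |α| * (2 * y) ^ 2 := by nlinarith [mul_nonneg this (sq_nonneg y)]
    _ ≤ _ := by gcongr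

/-! ### The integrand along a Shokurov cycle -/

/-- The pull-back of a form of the shape of `eis01D` to the cycle `(mX + nY){τ₁, τ₂}`, where
`ℓ, β, G, F, F'` are the values of `log |g|`, `dlog g` and of the three Eisenstein series at `τ`,
and `w` is the velocity of the path. -/
def cycleIntegrand (N : ℕ) (m n : ℤ) (ℓ β G F F' τ w : ℂ) : ℂ :=
  2 / N * ℓ * (1 / 2 * (-(3 * Complex.I) / (Real.pi * N) * G * (w * (m * τ + n))
      + starRingEnd ℂ (-(3 * Complex.I) / (Real.pi * N) * G * (w * (m * τ + n)))))
    - 1 / 2 * (2 / N * β * w - starRingEnd ℂ (2 / N * β * w)) *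
      (3 * τ.im / (2 * Real.pi * N) * (F * (m * τ + n) + F' * starRingEnd ℂ (m * τ + n)))

theorem levelVec_sigma_mul {N : ℕ} (u : Fin 2 → ZMod N) (g : GL (Fin 2) (ZMod N)) :
    levelVec u (sigma N * glTranspose g) = u ᵥ* g.val := by
  have h : ((sigma N).val)ᵀ * (sigma N).val = 1 := by
    ext i j
    fin_cases i <;> fin_cases j <;> simp [sigma, Matrix.mul_apply]
  rw [levelVec, Units.val_mul, Matrix.transpose_mul, Matrix.mul_assoc, h, mul_one]
  simp [glTranspose]

theorem shokurovIntegral_eq_integral_cuspPath {N : ℕ} (ω : TwoForm N) (m n : ℤ) (α : ℝ) {y : ℝ}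
    (hy : 0 < y) :
    shokurovIntegral m n (y * Complex.I) (α + y * Complex.I) ω
      = ∫ s in (0 : ℝ)..1, ∫ t in (0 : ℝ)..1,
        ω (sigma N) (cuspPath α y s, t * (m * cuspPath α y s + n))
          ![(cuspPathDeriv α y s, t * (m * cuspPathDeriv α y s)), (0, m * cuspPath α y s + n)] := by
  have hcyc : ∀ s t : ℝ, shokurovCycle m n (y * Complex.I) (α + y * Complex.I) s t
      = (cuspPath α y s, t * (m * cuspPath α y s + n)) := fun s t => by
    rw [shokurovCycle, geodesic_eq_cuspPath α s hy]
  have h1 : ∀ s t : ℝ,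
      deriv (fun s' : ℝ => shokurovCycle m n (y * Complex.I) (α + y * Complex.I) s' t)
      s = (cuspPathDeriv α y s, t * (m * cuspPathDeriv α y s)) := fun s t => by
    simp_rw [hcyc]
    have h := hasDerivAt_cuspPath α s hy
    exact (h.prodMk (((h.const_mul (m : ℂ)).add_const (n : ℂ)).const_mul (t : ℂ))).deriv
  have h2 : ∀ s t : ℝ,
      deriv (fun t' : ℝ => shokurovCycle m n (y * Complex.I) (α + y * Complex.I) s t')
      t = (0, m * cuspPath α y s + n) := fun s t => by
    simp_rw [hcyc]
    have h : HasDerivAt (fun t : ℝ => (t : ℂ)) 1 t := by simpa using hasDerivAt_ofReal_add t 0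
    have h' := h.mul_const (m * cuspPath α y s + n : ℂ)
    rw [one_mul] at h'
    exact ((hasDerivAt_const t (cuspPath α y s)).prodMk h').deriv
  simp_rw [shokurovIntegral, h1, h2, hcyc]

section

variable {N : ℕ} [NeZero N]

/-- On the cycle `Im z / Im τ = tm`, so `ν` vanishes on the tangent vector in `s` and equals `mτ +
n` on the one in `t`. Hence the value does not depend on `t`. -/
theorem pullback_eis01D_apply (u v : Fin 2 → ZMod N) (g : GL (Fin 2) (ZMod N)) (m n : ℤ)
    (τ w : ℂ) (t : ℝ) :
    pullback g (eis01D u v) (sigma N) (τ, t * (m * τ + n)) ![(w, t * (m * w)), (0, m * τ + n)]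
      = cycleIntegrand N m n (Real.log ‖siegelUnit (u ᵥ* g.val) τ‖ : ℝ)
        (logDeriv (siegelUnit (u ᵥ* g.val)) τ) (eisSeries 3 0 (v ᵥ* g.val) τ)
        (eisSeries 2 1 (v ᵥ* g.val) τ) (eisSeries 1 2 (v ᵥ* g.val) τ) τ w := by
  simp only [pullback, eis01D, eta1, eta2, Pi.add_apply]
  simp only [ContinuousAlternatingMap.add_apply, ContinuousAlternatingMap.smul_apply,
    ContinuousAlternatingMap.neg_apply, wedge_apply, piTwo, conjTwo, eis1hol, piOne, conjOne,
    eis0hol, eis1D, eis0D, nuForm, levelVec_sigma_mul, dtau, dz,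
    smul_apply, sub_apply,
    add_apply, ContinuousLinearMap.comp_apply]
  simp [wedge_apply, cycleIntegrand]
  ring

end

/-! ### Orders of growth along the geodesics from `iy` to `α + iy` -/

/-- The filter `y → ∞` on pairs `(y, s)`, uniformly in `s ∈ [0, 1]`. -/
def stripFilter : Filter (ℝ × ℝ) := atTop ×ˢ 𝓟 (Set.Icc 0 1)

theorem eventually_stripFilter {p : ℝ × ℝ → Prop} :
    (∀ᶠ x in stripFilter, p x) ↔ ∀ᶠ y in atTop, ∀ s ∈ Set.Icc (0 : ℝ) 1, p (y, s) := by
  rw [stripFilter, eventually_prod_principal_iff]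

theorem eventually_stripFilter_fst {p : ℝ → Prop} (h : ∀ᶠ y in atTop, p y) :
    ∀ᶠ x in stripFilter, p x.1 :=
  eventually_stripFilter.2 (h.mono fun _ hy _ _ => hy)

/-- `f(y, s) = O(y^a)`, uniformly in `s`. -/
def HasOrder (a : ℤ) (f : ℝ × ℝ → ℂ) : Prop := f =O[stripFilter] fun x => x.1 ^ a

theorem HasOrder.add {a : ℤ} {f g : ℝ × ℝ → ℂ} (hf : HasOrder a f) (hg : HasOrder a g) :
    HasOrder a (fun x => f x + g x) := Asymptotics.IsBigO.add hf hg

theorem HasOrder.sub {a : ℤ} {f g : ℝ × ℝ → ℂ} (hf : HasOrder a f) (hg : HasOrder a g) :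
    HasOrder a (fun x => f x - g x) := Asymptotics.IsBigO.sub hf hg

theorem HasOrder.mul {a b : ℤ} {f g : ℝ × ℝ → ℂ} (hf : HasOrder a f) (hg : HasOrder b g) :
    HasOrder (a + b) (fun x => f x * g x) := by
  refine (Asymptotics.IsBigO.mul hf hg).congr' EventuallyEq.rfl ?_
  filter_upwards [eventually_stripFilter_fst (eventually_ne_atTop 0)] with x hx
  rw [zpow_add₀ hx]

theorem HasOrder.conj {a : ℤ} {f : ℝ × ℝ → ℂ} (hf : HasOrder a f) :
    HasOrder a (fun x => starRingEnd ℂ (f x)) :=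
  (Asymptotics.isBigO_norm_left.1 (by simpa using Asymptotics.IsBigO.norm_left hf))

theorem hasOrder_const (c : ℂ) : HasOrder 0 (fun _ => c) := by
  simpa [HasOrder] using Asymptotics.isBigO_const_const c (one_ne_zero (α := ℝ)) stripFilter

theorem HasOrder.const_mul {a : ℤ} {f : ℝ × ℝ → ℂ} (c : ℂ) (hf : HasOrder a f) :
    HasOrder a (fun x => c * f x) := by simpa using (hasOrder_const c).mul hf

theorem HasOrder.mono {a b : ℤ} {f : ℝ × ℝ → ℂ} (hf : HasOrder a f) (h : a ≤ b) :
    HasOrder b f := by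
  refine Asymptotics.IsBigO.trans hf (Asymptotics.IsBigO.of_bound 1 ?_)
  filter_upwards [eventually_stripFilter_fst (eventually_ge_atTop 1)] with x hx
  rw [norm_zpow, norm_zpow, one_mul, Real.norm_of_nonneg (by linarith)]
  exact zpow_le_zpow_right₀ hx h

theorem HasOrder.of_bound {a : ℤ} {f : ℝ × ℝ → ℂ} (C : ℝ)
    (h : ∀ᶠ y : ℝ in atTop, ∀ s ∈ Set.Icc (0 : ℝ) 1, ‖f (y, s)‖ ≤ C * y ^ a) : HasOrder a f := by
  refine Asymptotics.IsBigO.of_bound C ?_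
  rw [eventually_stripFilter]
  filter_upwards [h, eventually_gt_atTop 0] with y hy h0 s hs
  rw [norm_zpow, Real.norm_of_nonneg h0.le]
  exact hy s hs

theorem tendsto_cuspPath_imInfty (α : ℝ) :
    Tendsto (fun x : ℝ × ℝ => cuspPath α x.1 x.2) stripFilter imInfty := by
  rw [imInfty, tendsto_comap_iff]
  refine tendsto_atTop_mono' _ (f₁ := Prod.fst) ?_ tendsto_fst
  exact eventually_stripFilter.2 ((eventually_gt_atTop 0).mono fun y hy s hs => le_im_cuspPath hy hs)

theorem hasOrder_of_imInfty (α : ℝ) {f : ℂ → ℂ} (hf : f =O[imInfty] fun τ => 1 / τ.im ^ 3) :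
    HasOrder (-3) fun x => f (cuspPath α x.1 x.2) := by
  refine (hf.comp_tendsto (tendsto_cuspPath_imInfty α)).trans (Asymptotics.IsBigO.of_bound 1 ?_)
  rw [eventually_stripFilter]
  filter_upwards [eventually_gt_atTop 0] with y hy s hs
  have h := le_im_cuspPath (α := α) hy hs
  have h0 := hy.trans_le h
  simp only [Function.comp]
  rw [Real.norm_of_nonneg (by positivity), Real.norm_of_nonneg (by positivity), one_mul,
    zpow_neg, ← one_div]
  norm_cast
  gcongr

theorem hasOrder_cuspPath (α : ℝ) : HasOrder 1 fun x => cuspPath α x.1 x.2 := by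
  refine HasOrder.of_bound 2 ?_
  filter_upwards [eventually_gt_atTop 0, eventually_ge_atTop |α|] with y hy hα s hs
  have := norm_cuspPath_le (α := α) hy hs
  rw [zpow_one]
  linarith

theorem hasOrder_im_cuspPath (α : ℝ) :
    HasOrder 1 fun x => ((cuspPath α x.1 x.2).im : ℂ) := by
  refine Asymptotics.IsBigO.trans (Asymptotics.IsBigO.of_bound 1 (Eventually.of_forall fun x => ?_))
    (hasOrder_cuspPath α)
  rw [Complex.norm_real, one_mul]
  exact Complex.abs_im_le_norm _

theorem hasOrder_cuspPathDeriv (α : ℝ) : HasOrder 0 fun x => cuspPathDeriv α x.1 x.2 := by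
  refine HasOrder.of_bound (2 * |α|) ?_
  filter_upwards [eventually_gt_atTop 0, eventually_ge_atTop |α|] with y hy hα s hs
  simpa using norm_cuspPathDeriv_le hy hα

/-- The integrand is real-bilinear in `(ℓ, G)` plus real-bilinear in `(β, (F, F'))`; one argument is
changed at a time. -/
theorem cycleIntegrand_sub (N : ℕ) (m n : ℤ) (ℓ β G F F' ℓ₀ β₀ G₀ F₀ F₀' τ w : ℂ) :
    cycleIntegrand N m n ℓ β G F F' τ w - cycleIntegrand N m n ℓ₀ β₀ G₀ F₀ F₀' τ w
      = (cycleIntegrand N m n (ℓ - ℓ₀) 0 G 0 0 τ w + cycleIntegrand N m n ℓ₀ 0 (G - G₀) 0 0 τ w)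
        + (cycleIntegrand N m n 0 (β - β₀) 0 F F' τ w
          + cycleIntegrand N m n 0 β₀ 0 (F - F₀) (F' - F₀') τ w) := by
  simp only [cycleIntegrand, map_mul, map_sub, map_zero]
  ring

theorem HasOrder.cycleIntegrand_left (N : ℕ) (m n : ℤ) (α : ℝ) {a b : ℤ} {ℓ G : ℝ × ℝ → ℂ}
    (hl : HasOrder a ℓ) (hG : HasOrder b G) :
    HasOrder (a + b + 1) fun x => cycleIntegrand N m n (ℓ x) 0 (G x) 0 0
      (cuspPath α x.1 x.2) (cuspPathDeriv α x.1 x.2) := by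
  have hQ : HasOrder 1 fun x => m * cuspPath α x.1 x.2 + n :=
    ((hasOrder_cuspPath α).const_mul m).add ((hasOrder_const n).mono (by norm_num))
  have hΩ := (hG.const_mul (-(3 * Complex.I) / (Real.pi * N))).mul ((hasOrder_cuspPathDeriv α).mul hQ)
  have h := (hl.const_mul (2 / N : ℂ)).mul ((hΩ.add hΩ.conj).const_mul (1 / 2))
  rw [zero_add, ← add_assoc] at h
  simpa [cycleIntegrand] using h

/-- The extra 2 comes from `mτ + n` and from the factor `Im τ` of `eis1D`; the velocity is bounded.
-/
theorem HasOrder.cycleIntegrand_right (N : ℕ) (m n : ℤ) (α : ℝ) {a b : ℤ} {β F F' : ℝ × ℝ → ℂ}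
    (hβ : HasOrder a β) (hF : HasOrder b F) (hF' : HasOrder b F') :
    HasOrder (a + b + 2) fun x => cycleIntegrand N m n 0 (β x) 0 (F x) (F' x)
      (cuspPath α x.1 x.2) (cuspPathDeriv α x.1 x.2) := by
  have hQ : HasOrder 1 fun x => m * cuspPath α x.1 x.2 + n :=
    ((hasOrder_cuspPath α).const_mul m).add ((hasOrder_const n).mono (by norm_num))
  have hB := (hβ.const_mul (2 / N : ℂ)).mul (hasOrder_cuspPathDeriv α)
  have hE := (((hasOrder_im_cuspPath α).const_mul (3 / (2 * Real.pi * N))).mul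
    ((hF.mul hQ).add (hF'.mul hQ.conj)))
  have h := (((hB.sub hB.conj).const_mul (1 / 2)).mul hE).const_mul (-1)
  rw [show a + 0 + (1 + (b + 1)) = a + b + 2 by ring] at h
  refine Asymptotics.IsBigO.congr_left h fun x => ?_
  simp only [cycleIntegrand, map_mul, map_zero]
  ring

/-! ### The leading term of the integrand and its integral -/

section

variable {N : ℕ} [NeZero N]

/-- The contribution to the residue of the limit `log |siegelConst w|` of `log |g_w| + π B₂ Im τ`
at the cusp. -/
def logResidue (w v : Fin 2 → ZMod N) : ℝ :=
  -(8 * Real.pi ^ 2 / N ^ 2) * Real.log ‖siegelConst w‖ * bernoulliFun 3 (frac (v 0))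

/-- The constant term of `Im τ ^ 2 * eisSeries 2 1 v τ` at the cusp. -/
def eisConst (v : Fin 2 → ZMod N) : ℂ :=
  if v 0 = 0 then -(Real.pi * Complex.I / 2) * (zetaHat (v 1) 2 - zetaHat (-v 1) 2) else 0

/-- The leading term of the integrand. -/
def leadingTerm (w v : Fin 2 → ZMod N) (m n : ℤ) (τ δ : ℂ) : ℂ :=
  logResidue w v * ((δ * (m * τ + n)).re : ℂ)
    - 8 * Real.pi ^ 3 / N ^ 2 * (bernoulliFun 2 (frac (w 0)) : ℝ) *
      (bernoulliFun 3 (frac (v 0)) : ℝ) * m * ((τ.im ^ 2 * δ.im : ℝ) : ℂ)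
    + 6 / N ^ 2 * (bernoulliFun 2 (frac (w 0)) : ℝ) * eisConst v * m * (δ.re : ℂ)

/-- The `B₂ B₃` terms in `Re δ` from the two halves of the form cancel, leaving one in `Y² Im δ`.
The opposite signs of `eisConst v` single out `Im (mτ + n) = mY`, and the powers of `Y` cancel. -/
theorem cycleIntegrand_leading (w v : Fin 2 → ZMod N) (m n : ℤ) {τ : ℂ} (hτ : τ.im ≠ 0) (δ : ℂ) :
    cycleIntegrand N m n
      ((-(Real.pi * bernoulliFun 2 (frac (w 0)) * τ.im) + Real.log ‖siegelConst w‖ : ℝ) : ℂ)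
      (Real.pi * Complex.I * (bernoulliFun 2 (frac (w 0)) : ℝ))
      (-(4 * Real.pi ^ 3 * Complex.I / 3) * (bernoulliFun 3 (frac (v 0)) : ℝ))
      (-(4 * Real.pi ^ 3 * Complex.I / 3) * (bernoulliFun 3 (frac (v 0)) : ℝ)
        + eisConst v / (τ.im : ℂ) ^ 2)
      (-(4 * Real.pi ^ 3 * Complex.I / 3) * (bernoulliFun 3 (frac (v 0)) : ℝ)
        - eisConst v / (τ.im : ℂ) ^ 2) τ δ
      = leadingTerm w v m n τ δ := by
  have hN : (N : ℂ) ≠ 0 := by exact_mod_cast NeZero.ne N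
  have hπ : (Real.pi : ℂ) ≠ 0 := by exact_mod_cast Real.pi_ne_zero
  obtain ⟨x, Y⟩ := τ
  obtain ⟨p, q⟩ := δ
  simp only at hτ
  have hY : (Y : ℂ) ≠ 0 := by exact_mod_cast hτ
  have hre : (((⟨p, q⟩ : ℂ) * (m * (⟨x, Y⟩ : ℂ) + n)).re : ℂ) = p * (m * x + n) - q * (m * Y) := by
    simp
  have h3 : starRingEnd ℂ (3 : ℂ) = 3 := Complex.conj_ofNat 3
  have h2 : starRingEnd ℂ (2 : ℂ) = 2 := Complex.conj_ofNat 2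
  have h4 : starRingEnd ℂ (4 : ℂ) = 4 := Complex.conj_ofNat 4
  simp only [leadingTerm, hre]
  simp only [cycleIntegrand, logResidue, Complex.mk_eq_add_mul_I]
  generalize eisConst v = A
  generalize Real.log ‖siegelConst w‖ = L
  generalize bernoulliFun 2 (frac (w 0)) = B2
  generalize bernoulliFun 3 (frac (v 0)) = B3
  simp only [map_mul, map_add, map_neg, map_div₀, map_pow, Complex.conj_ofReal, Complex.conj_I,
    map_natCast, map_intCast, h2, h3, h4]
  push_cast
  field_simp
  ring_nf
  simp only [Complex.I_pow_four, Complex.I_sq]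
  ring

theorem continuous_leadingTerm (w v : Fin 2 → ZMod N) (m n : ℤ) (α : ℝ) {y : ℝ} (hy : 0 < y) :
    Continuous fun s => leadingTerm w v m n (cuspPath α y s) (cuspPathDeriv α y s) := by
  have h := continuous_cuspPath α hy
  have h' := continuous_cuspPathDeriv α hy
  revert h h'
  generalize cuspPath α y = f, cuspPathDeriv α y = f'
  intro h h'
  unfold leadingTerm
  fun_prop

/-- The limit of the integrals over the cycles `(mX + nY){iy, α + iy}`. -/
def cuspResidue (w v : Fin 2 → ZMod N) (m n : ℤ) (α : ℝ) : ℂ :=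
  logResidue w v * (m * α ^ 2 / 2 + n * α)
    + 6 / N ^ 2 * (bernoulliFun 2 (frac (w 0)) : ℝ) * eisConst v * m * α

/-- The primitive combines `Re(mτ²/2 + nτ)`, `(Im τ)³/3` and `Re τ`. Both endpoints have height `y`,
so the cubic term and the `y²` of the quadratic one cancel, and the value is independent of `y`. -/
theorem integral_leadingTerm (w v : Fin 2 → ZMod N) (m n : ℤ) (α : ℝ) {y : ℝ} (hy : 0 < y) :
    ∫ s in (0 : ℝ)..1, leadingTerm w v m n (cuspPath α y s) (cuspPathDeriv α y s)
      = cuspResidue w v m n α := by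
  have hd : ∀ s, HasDerivAt (fun s => (logResidue w v : ℂ) *
      ((m * cuspPath α y s ^ 2 / 2 + n * cuspPath α y s : ℂ).re : ℂ)
      - 8 * Real.pi ^ 3 / N ^ 2 * (bernoulliFun 2 (frac (w 0)) : ℝ) *
      (bernoulliFun 3 (frac (v 0)) : ℝ) * m * (((cuspPath α y s).im ^ 3 / 3 : ℝ) : ℂ)
      + 6 / N ^ 2 * (bernoulliFun 2 (frac (w 0)) : ℝ) * eisConst v * m
        * ((cuspPath α y s).re : ℂ))
      (leadingTerm w v m n (cuspPath α y s) (cuspPathDeriv α y s)) s := fun s => by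
    have h := hasDerivAt_cuspPath α s hy
    have hre : HasDerivAt (fun s => (cuspPath α y s).re) (cuspPathDeriv α y s).re s :=
      Complex.reCLM.hasFDerivAt.comp_hasDerivAt s h
    have him : HasDerivAt (fun s => (cuspPath α y s).im) (cuspPathDeriv α y s).im s :=
      Complex.imCLM.hasFDerivAt.comp_hasDerivAt s h
    have h1 : HasDerivAt (fun s => (m * cuspPath α y s ^ 2 / 2 + n * cuspPath α y s : ℂ))
        (cuspPathDeriv α y s * (m * cuspPath α y s + n)) s := by
      convert! (((h.fun_pow 2).const_mul (m : ℂ)).div_const 2).add (h.const_mul (n : ℂ)) using 1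
      norm_num
      ring
    have h1re : HasDerivAt (fun s => (m * cuspPath α y s ^ 2 / 2 + n * cuspPath α y s : ℂ).re)
        (cuspPathDeriv α y s * (m * cuspPath α y s + n)).re s :=
      Complex.reCLM.hasFDerivAt.comp_hasDerivAt s h1
    have h3 : HasDerivAt (fun s => (cuspPath α y s).im ^ 3 / 3)
        ((cuspPath α y s).im ^ 2 * (cuspPathDeriv α y s).im) s := by
      convert! (him.fun_pow 3).div_const 3 using 1
      norm_num
      ring
    exact ((h1re.ofReal_comp.const_mul _).sub (h3.ofReal_comp.const_mul _)).add
      (hre.ofReal_comp.const_mul _)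
  rw [intervalIntegral.integral_eq_sub_of_hasDerivAt (fun s _ => hd s)
    ((continuous_leadingTerm w v m n α hy).intervalIntegrable _ _)]
  have e1 : (m * ((α : ℂ) + y * Complex.I) ^ 2 / 2 + n * ((α : ℂ) + y * Complex.I) : ℂ).re
      = m * (α ^ 2 - y ^ 2) / 2 + n * α := by
    have : (m * ((α : ℂ) + y * Complex.I) ^ 2 / 2 + n * ((α : ℂ) + y * Complex.I) : ℂ)
        = ((m * (α ^ 2 - y ^ 2) / 2 + n * α : ℝ) : ℂ)
          + ((m * α * y + n * y : ℝ) : ℂ) * Complex.I := by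
      push_cast
      linear_combination (m * (y : ℂ) ^ 2 / 2) * Complex.I_sq
    rw [this, Complex.add_re, Complex.ofReal_re, Complex.re_ofReal_mul]; simp
  have e2 : (m * ((y : ℂ) * Complex.I) ^ 2 / 2 + n * ((y : ℂ) * Complex.I) : ℂ).re
      = m * (- y ^ 2) / 2 := by
    have : (m * ((y : ℂ) * Complex.I) ^ 2 / 2 + n * ((y : ℂ) * Complex.I) : ℂ)
        = ((m * (- y ^ 2) / 2 : ℝ) : ℂ) + ((n * y : ℝ) : ℂ) * Complex.I := by
      push_cast
      linear_combination (m * (y : ℂ) ^ 2 / 2) * Complex.I_sq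
    rw [this, Complex.add_re, Complex.ofReal_re, Complex.re_ofReal_mul]; simp
  rw [cuspPath_one α hy, cuspPath_zero, e1, e2, cuspResidue]
  have e3 : ((α : ℂ) + y * Complex.I).im = y := by simp
  have e4 : ((y : ℂ) * Complex.I).im = y := by simp
  have e5 : ((α : ℂ) + y * Complex.I).re = α := by simp
  have e6 : ((y : ℂ) * Complex.I).re = 0 := by simp
  rw [e3, e4, e5, e6]
  push_cast
  ring

/-! ### The integrand is close to its leading term -/

/-- The integrand over the cycle `(mX + nY){iy, α + iy}`. -/
def cuspIntegrand (w v : Fin 2 → ZMod N) (m n : ℤ) (τ δ : ℂ) : ℂ :=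
  cycleIntegrand N m n (Real.log ‖siegelUnit w τ‖ : ℝ) (logDeriv (siegelUnit w) τ)
    (eisSeries 3 0 v τ) (eisSeries 2 1 v τ) (eisSeries 1 2 v τ) τ δ

theorem hasOrder_cuspIntegrand_sub {w : Fin 2 → ZMod N} (hw : w ≠ 0) (v : Fin 2 → ZMod N)
    (m n : ℤ) (α : ℝ) : HasOrder (-1) fun x =>
      cuspIntegrand w v m n (cuspPath α x.1 x.2) (cuspPathDeriv α x.1 x.2)
        - leadingTerm w v m n (cuspPath α x.1 x.2) (cuspPathDeriv α x.1 x.2) := by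
  have hℓ := hasOrder_of_imInfty α (f := fun τ => ((Real.log ‖siegelUnit w τ‖ -
    (-(Real.pi * bernoulliFun 2 (frac (w 0)) * τ.im) + Real.log ‖siegelConst w‖) : ℝ) : ℂ))
    (Complex.isBigO_ofReal_left.2 (log_norm_siegelUnit_isBigO hw))
  have hβ := hasOrder_of_imInfty α (logDeriv_siegelUnit_isBigO hw)
  have hG := hasOrder_of_imInfty α (eisSeries_sub_isBigO (by norm_num) isRowKernel_three_zero v)
  have hF := hasOrder_of_imInfty α (eisSeries_sub_isBigO (by norm_num) isRowKernel_two_one v)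
  have hF' := hasOrder_of_imInfty α (eisSeries_sub_isBigO (by norm_num) isRowKernel_one_two v)
  have e1 : (if v 0 = 0 then -(Real.pi * Complex.I / 2) * (zetaHat (v 1) 2 - zetaHat (-v 1) 2)
    else 0) = eisConst v := rfl
  have e2 : (if v 0 = 0 then Real.pi * Complex.I / 2 * (zetaHat (v 1) 2 - zetaHat (-v 1) 2)
    else 0) = -eisConst v := by
    unfold eisConst; split_ifs <;> ring
  simp only [zero_mul, ite_self, zero_div, add_zero] at hG
  simp only [e1] at hF
  simp only [e2, neg_div, ← sub_eq_add_neg] at hF'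
  set B2 := bernoulliFun 2 (frac (w 0)) with hB2
  set G0 : ℂ := -(4 * Real.pi ^ 3 * Complex.I / 3) * (bernoulliFun 3 (frac (v 0)) : ℝ) with hG0
  have hY : HasOrder 0 fun x => eisConst v / ((cuspPath α x.1 x.2).im : ℂ) ^ 2 := by
    refine HasOrder.of_bound ‖eisConst v‖ ?_
    filter_upwards [eventually_ge_atTop 1] with y hy s hs
    have h := le_im_cuspPath (α := α) (by linarith) hs
    have h1 : 1 ≤ (cuspPath α y s).im ^ 2 := one_le_pow₀ (hy.trans h)
    rw [norm_div, norm_pow, Complex.norm_real, Real.norm_eq_abs, sq_abs, zpow_zero, mul_one]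
    exact div_le_self (norm_nonneg _) h1
  have hG1 := (hG.mono (by norm_num : (-3 : ℤ) ≤ 0)).add (hasOrder_const G0)
  have hF1 := (hF.mono (by norm_num : (-3 : ℤ) ≤ 0)).add ((hasOrder_const G0).add hY)
  have hF1' := (hF'.mono (by norm_num : (-3 : ℤ) ≤ 0)).add ((hasOrder_const G0).sub hY)
  simp only [sub_add_cancel] at hG1 hF1 hF1'
  have hℓ0 : HasOrder 1 fun x => ((-(Real.pi * B2 * (cuspPath α x.1 x.2).im)
      + Real.log ‖siegelConst w‖ : ℝ) : ℂ) := by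
    have := ((hasOrder_im_cuspPath α).const_mul (-(Real.pi * B2))).add
      ((hasOrder_const (Real.log ‖siegelConst w‖ : ℝ)).mono zero_le_one)
    refine Asymptotics.IsBigO.congr_left this fun x => ?_
    push_cast; ring
  have t1 := HasOrder.cycleIntegrand_left N m n α hℓ hG1
  have t2 := HasOrder.cycleIntegrand_left N m n α hℓ0 hG
  have t3 := HasOrder.cycleIntegrand_right N m n α hβ hF1 hF1'
  have t4 := HasOrder.cycleIntegrand_right N m n α
    (hasOrder_const (Real.pi * Complex.I * B2)) hF hF'
  -- The four orders are `-2`, `-1`, `-1` and `-1`.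
  have t := ((t1.mono (by norm_num : _ ≤ (-1 : ℤ))).add (t2.mono (by norm_num))).add
    ((t3.mono (by norm_num)).add (t4.mono (by norm_num)))
  refine Asymptotics.IsBigO.congr' t ?_ EventuallyEq.rfl
  rw [EventuallyEq, eventually_stripFilter]
  filter_upwards [eventually_gt_atTop 0] with y hy s hs
  have him : (cuspPath α y s).im ≠ 0 := (hy.trans_le (le_im_cuspPath hy hs)).ne'
  rw [← cycleIntegrand_leading w v m n him, cuspIntegrand, cycleIntegrand_sub]
  push_cast
  rfl

/-! ### Integrability -/

open MeasureTheory in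
-- A pointwise limit of finite sums; measurability is enough, since boundedness comes from the
-- asymptotics.
theorem aemeasurable_eisSeries {j k : ℕ} (h : j + k = 3) (v : Fin 2 → ZMod N) (α : ℝ) {y : ℝ}
    (hy : 0 < y) : AEMeasurable (fun s => eisSeries j k v (cuspPath α y s))
      (volume.restrict (Set.Ioc 0 1)) := by
  have hm := (continuous_cuspPath α hy).measurable
  refine aemeasurable_of_tendsto_metrizable_ae (atTop : Filter (Finset (ℤ × ℤ)))
    (f := fun F s => ∑ x ∈ F, eisTerm j k v (cuspPath α y s) x) (fun F => ?_) ?_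
  · refine (Finset.measurable_fun_sum _ fun x _ => ?_).aemeasurable
    unfold eisTerm
    have hc := Complex.continuous_conj.measurable.comp hm
    exact measurable_const.div ((((hm.const_mul _).add_const _).pow_const _).mul
      (((hc.const_mul _).add_const _).pow_const _))
  · refine (ae_restrict_iff' measurableSet_Ioc).2 (Eventually.of_forall fun s hs => ?_)
    rw [eisSeries_eq_tsum h]
    exact (summable_eisTerm h v (hy.trans_le
      (le_im_cuspPath hy (Set.Ioc_subset_Icc_self hs)))).hasSum

open MeasureTheory in
theorem aemeasurable_cuspIntegrand (w v : Fin 2 → ZMod N) (m n : ℤ) (α : ℝ) {y : ℝ} (hy : 1 < y) :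
    AEMeasurable (fun s => cuspIntegrand w v m n (cuspPath α y s) (cuspPathDeriv α y s))
      (volume.restrict (Set.Ioc 0 1)) := by
  have hy0 : 0 < y := by linarith
  have hm := (continuous_cuspPath α hy0).measurable.aemeasurable
    (μ := volume.restrict (Set.Ioc (0 : ℝ) 1))
  have hm' := (continuous_cuspPathDeriv α hy0).measurable.aemeasurable
    (μ := volume.restrict (Set.Ioc (0 : ℝ) 1))
  have hmaps : Set.MapsTo (cuspPath α y) (Set.Ioc 0 1) {τ : ℂ | 1 < τ.im} := fun s hs =>
    hy.trans_le (le_im_cuspPath hy0 (Set.Ioc_subset_Icc_self hs))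
  have hg : AEMeasurable (fun s => siegelUnit w (cuspPath α y s))
      (volume.restrict (Set.Ioc (0 : ℝ) 1)) :=
    ((differentiableOn_siegelUnit w).continuousOn.comp
      (continuous_cuspPath α hy0).continuousOn hmaps).aemeasurable measurableSet_Ioc
  have hg' : AEMeasurable (fun s => deriv (siegelUnit w) (cuspPath α y s))
      (volume.restrict (Set.Ioc (0 : ℝ) 1)) :=
    (((differentiableOn_siegelUnit w).deriv isOpen_one_lt_im).continuousOn.comp
      (continuous_cuspPath α hy0).continuousOn hmaps).aemeasurable measurableSet_Ioc
  have hℓ := Complex.measurable_ofReal.comp_aemeasurable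
    (Real.measurable_log.comp_aemeasurable hg.norm)
  have hβ := hg'.div hg
  have hG := aemeasurable_eisSeries (j := 3) (k := 0) rfl v α hy0
  have hF := aemeasurable_eisSeries (j := 2) (k := 1) rfl v α hy0
  have hF' := aemeasurable_eisSeries (j := 1) (k := 2) rfl v α hy0
  have hY := Complex.measurable_ofReal.comp_aemeasurable
    (Complex.measurable_im.comp_aemeasurable hm)
  have hQ := (hm.const_mul (m : ℂ)).add_const (n : ℂ)
  have hconj : ∀ {f : ℝ → ℂ}, AEMeasurable f (volume.restrict (Set.Ioc (0 : ℝ) 1)) →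
      AEMeasurable (fun s => starRingEnd ℂ (f s)) (volume.restrict (Set.Ioc (0 : ℝ) 1)) :=
    fun hf => Complex.continuous_conj.measurable.comp_aemeasurable hf
  have hΩ := (hG.const_mul (-(3 * Complex.I) / (Real.pi * N))).mul (hm'.mul hQ)
  have hB := (hβ.const_mul (2 / N : ℂ)).mul hm'
  exact ((hℓ.const_mul (2 / N : ℂ)).mul ((hΩ.add (hconj hΩ)).const_mul (1 / 2))).sub
    (((hB.sub (hconj hB)).const_mul (1 / 2)).mul
      (((hY.const_mul 3).div_const (2 * Real.pi * N : ℂ)).mul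
        ((hF.mul hQ).add (hF'.mul (hconj hQ)))))

/-- Integrability is recorded with the limit because the integral of a difference of two such forms
must be split. -/
theorem eventually_intervalIntegrable_cuspIntegrand {w : Fin 2 → ZMod N} (hw : w ≠ 0)
    (v : Fin 2 → ZMod N) (m n : ℤ) (α : ℝ) :
    (∀ᶠ y : ℝ in atTop, IntervalIntegrable (fun s =>
        cuspIntegrand w v m n (cuspPath α y s) (cuspPathDeriv α y s)) MeasureTheory.volume 0 1) ∧
      Tendsto (fun y : ℝ => ∫ s in (0 : ℝ)..1,
        cuspIntegrand w v m n (cuspPath α y s) (cuspPathDeriv α y s)) atTop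
        (𝓝 (cuspResidue w v m n α)) := by
  obtain ⟨C, hC⟩ := (hasOrder_cuspIntegrand_sub hw v m n α).bound
  rw [eventually_stripFilter] at hC
  have hint : ∀ᶠ y : ℝ in atTop, IntervalIntegrable (fun s =>
        cuspIntegrand w v m n (cuspPath α y s) (cuspPathDeriv α y s)
        - leadingTerm w v m n (cuspPath α y s) (cuspPathDeriv α y s))
        MeasureTheory.volume 0 1 := by
    filter_upwards [hC, eventually_gt_atTop 1] with y hC hy
    have hy0 : 0 < y := by linarith
    rw [intervalIntegrable_iff_integrableOn_Ioc_of_le zero_le_one]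
    refine MeasureTheory.Integrable.of_bound ?_ (C * ‖y ^ (-1 : ℤ)‖) ?_
    · exact ((aemeasurable_cuspIntegrand w v m n α hy).sub
        (continuous_leadingTerm w v m n α hy0).measurable.aemeasurable).aestronglyMeasurable
    · exact (MeasureTheory.ae_restrict_iff' measurableSet_Ioc).2
        (Eventually.of_forall fun s hs => hC s (Set.Ioc_subset_Icc_self hs))
  have hint' : ∀ᶠ y : ℝ in atTop, IntervalIntegrable (fun s =>
      leadingTerm w v m n (cuspPath α y s) (cuspPathDeriv α y s)) MeasureTheory.volume 0 1 := by
    filter_upwards [eventually_gt_atTop 0] with y hy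
    exact (continuous_leadingTerm w v m n α hy).intervalIntegrable _ _
  constructor
  · filter_upwards [hint, hint'] with y h1 h2
    simpa using h1.add h2
  · have h0 : Tendsto (fun y : ℝ => C * ‖y ^ (-1 : ℤ)‖) atTop (𝓝 0) := by
      have : Tendsto (fun y : ℝ => y ^ (-1 : ℤ)) atTop (𝓝 0) := by
        simpa using tendsto_inv_atTop_zero (𝕜 := ℝ)
      simpa using this.norm.const_mul C
    have h1 : Tendsto (fun y : ℝ => ∫ s in (0 : ℝ)..1,
        (cuspIntegrand w v m n (cuspPath α y s) (cuspPathDeriv α y s)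
        - leadingTerm w v m n (cuspPath α y s) (cuspPathDeriv α y s))) atTop (𝓝 0) := by
      refine squeeze_zero_norm' ?_ h0
      filter_upwards [hC] with y hC
      refine (intervalIntegral.norm_integral_le_of_norm_le_const fun s hs => hC s ?_).trans
        (by simp)
      rw [Set.uIoc_of_le zero_le_one] at hs
      exact Set.Ioc_subset_Icc_self hs
    rw [← zero_add (cuspResidue w v m n α)]
    refine (h1.add_const (cuspResidue w v m n α)).congr' ?_
    filter_upwards [hint, hint', eventually_gt_atTop 0] with y h1 h2 hy
    rw [← integral_leadingTerm w v m n α hy, ← intervalIntegral.integral_add h1 h2]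
    simp

end

/-! ### Residues at the cusps -/

section

theorem vecMul_ne_zero {N : ℕ} {u : Fin 2 → ZMod N} (hu : u ≠ 0) (g : GL (Fin 2) (ZMod N)) :
    u ᵥ* g.val ≠ 0 := fun h => hu (by
  have h1 : (u ᵥ* g.val) ᵥ* (g⁻¹).val = u := by
    rw [Matrix.vecMul_vecMul, Units.mul_inv, Matrix.vecMul_one]
  rw [← h1, h, Matrix.zero_vecMul])

variable {N : ℕ} [NeZero N]

theorem pullback_eis01D_apply_eq_cuspIntegrand (u v : Fin 2 → ZMod N) (g : GL (Fin 2) (ZMod N)) (m n : ℤ)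
    (τ w : ℂ) (t : ℝ) :
    pullback g (eis01D u v) (sigma N) (τ, t * (m * τ + n)) ![(w, t * (m * w)), (0, m * τ + n)]
      = cuspIntegrand (u ᵥ* g.val) (v ᵥ* g.val) m n τ w :=
  pullback_eis01D_apply u v g m n τ w t

theorem tendsto_shokurovIntegral_eis01D {u : Fin 2 → ZMod N} (hu : u ≠ 0) (v : Fin 2 → ZMod N)
    (g : GL (Fin 2) (ZMod N)) (m n : ℤ) (α : ℝ) :
    Tendsto (fun y : ℝ => shokurovIntegral m n (y * Complex.I) (α + y * Complex.I)
      (pullback g (eis01D u v))) atTop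
      (𝓝 (cuspResidue (u ᵥ* g.val) (v ᵥ* g.val) m n α)) := by
  refine (eventually_intervalIntegrable_cuspIntegrand (vecMul_ne_zero hu g) (v ᵥ* g.val) m n α).2.congr'
    ?_
  filter_upwards [eventually_gt_atTop 0] with y hy
  rw [shokurovIntegral_eq_integral_cuspPath _ m n α hy]
  simp_rw [pullback_eis01D_apply_eq_cuspIntegrand]
  simp

theorem tendsto_shokurovIntegral_eis01D_sub {u u' : Fin 2 → ZMod N} (hu : u ≠ 0) (hu' : u' ≠ 0)
    (v : Fin 2 → ZMod N) (g : GL (Fin 2) (ZMod N)) (m n : ℤ) (α : ℝ) :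
    Tendsto (fun y : ℝ => shokurovIntegral m n (y * Complex.I) (α + y * Complex.I)
      (pullback g (eis01D u v - eis01D u' v))) atTop
      (𝓝 (cuspResidue (u ᵥ* g.val) (v ᵥ* g.val) m n α
        - cuspResidue (u' ᵥ* g.val) (v ᵥ* g.val) m n α)) := by
  obtain ⟨hi, ht⟩ := eventually_intervalIntegrable_cuspIntegrand (vecMul_ne_zero hu g)
    (v ᵥ* g.val) m n α
  obtain ⟨hi', ht'⟩ := eventually_intervalIntegrable_cuspIntegrand (vecMul_ne_zero hu' g)
    (v ᵥ* g.val) m n α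
  refine (ht.sub ht').congr' ?_
  filter_upwards [eventually_gt_atTop 0, hi, hi'] with y hy hi hi'
  rw [shokurovIntegral_eq_integral_cuspPath _ m n α hy, ← intervalIntegral.integral_sub hi hi']
  have h : ∀ (p : ℂ × ℂ) (x : Fin 2 → ℂ × ℂ),
      pullback g (eis01D u v - eis01D u' v) (sigma N) p x
        = pullback g (eis01D u v) (sigma N) p x - pullback g (eis01D u' v) (sigma N) p x :=
    fun _ _ => rfl
  simp_rw [h, pullback_eis01D_apply_eq_cuspIntegrand]
  simp

theorem cuspResidue_eq (a b c d : ZMod N) (m n : ℤ) (α : ℝ) :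
    cuspResidue ![a, b] ![c, d] m n α
      = -(8 * Real.pi ^ 2 / N ^ 2) * (if a = 0 then 1 else 0) * Real.log ‖1 - zetaPow b‖
          * bernoulliFun 3 (frac c) * (m * α ^ 2 / 2 + n * α)
        + 3 * Real.pi * Complex.I / N ^ 2 * bernoulliFun 2 (frac a) * (if c = 0 then 1 else 0)
          * (zetaHat (-d) 2 - zetaHat d 2) * (m * α) := by
  simp only [cuspResidue, logResidue, siegelConst, eisConst, Matrix.cons_val_zero,
    Matrix.cons_val_one]
  by_cases ha : a = 0 <;> by_cases hc : c = 0 <;> simp [ha, hc] <;> ring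

/-! ### Arithmetic of the indices modulo `N` -/

theorem bernoulliFun_two_frac_neg (a : ZMod N) :
    bernoulliFun 2 (frac (-a)) = bernoulliFun 2 (frac a) := by
  rcases eq_or_ne a 0 with rfl | ha
  · simp
  · have hN : (N : ℝ) ≠ 0 := by exact_mod_cast NeZero.ne N
    have : NeZero a := ⟨ha⟩
    have : frac (-a) = 1 - frac a := by
      rw [frac, frac, ZMod.val_neg_of_ne_zero, Nat.cast_sub (ZMod.val_lt a).le]
      field_simp
    rw [this, bernoulliFun_eval_one_sub]
    ring

/-- By Bézout, `gcd(d, N)` is a multiple of `d` modulo `N`. -/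
theorem natCast_gcd_mul_eq_zero {d p : ZMod N} (h : d * p = 0) :
    ((Nat.gcd d.val N : ℕ) : ZMod N) * p = 0 := by
  have h1 := congrArg (Int.cast : ℤ → ZMod N) (Nat.gcd_eq_gcd_ab d.val N)
  push_cast at h1
  rw [ZMod.natCast_zmod_val, ZMod.natCast_self, zero_mul, add_zero] at h1
  rw [h1, mul_right_comm, h, zero_mul]

theorem mul_eq_mul_of_modEq_gcd {d p : ZMod N} (h : d * p = 0) {x y : ℤ}
    (hxy : x ≡ y [ZMOD (Nat.gcd d.val N : ℕ)]) : (x : ZMod N) * p = y * p := by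
  obtain ⟨k, hk⟩ := hxy.dvd
  have h1 := congrArg (Int.cast : ℤ → ZMod N) hk
  push_cast at h1
  rw [eq_comm, ← sub_eq_zero, ← sub_mul, h1, mul_right_comm, natCast_gcd_mul_eq_zero h, zero_mul]

theorem bernoulliFun_two_frac_eq_of_modEq {b b' d p : ZMod N} (h : d * p = 0)
    (hb : (b.val : ℤ) ≡ b'.val [ZMOD (Nat.gcd d.val N : ℕ)] ∨
        (b.val : ℤ) ≡ -b'.val [ZMOD (Nat.gcd d.val N : ℕ)]) :
    bernoulliFun 2 (frac (b * p)) = bernoulliFun 2 (frac (b' * p)) := by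
  rcases hb with hb | hb
  · have := mul_eq_mul_of_modEq_gcd h hb
    push_cast at this
    rw [ZMod.natCast_zmod_val, ZMod.natCast_zmod_val] at this
    rw [this]
  · have := mul_eq_mul_of_modEq_gcd h hb
    push_cast at this
    rw [ZMod.natCast_zmod_val, ZMod.natCast_zmod_val, neg_mul] at this
    rw [this, bernoulliFun_two_frac_neg]

theorem bernoulliFun_three_zero : bernoulliFun 3 0 = 0 := by
  rw [bernoulliFun_eval_zero, bernoulli_eq_zero_of_odd (by decide) (by norm_num), Rat.cast_zero]

/-- The logarithmic term disappears: `bp = 0` forces `dp = 0`, where `B₃` vanishes. -/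
theorem cuspResidue_eq_of_dvd {b d : ZMod N} (hbd : b ∣ d) (p q : ZMod N) (m n : ℤ) (α : ℝ) :
    cuspResidue ![b * p, b * q] ![d * p, d * q] m n α
      = 3 * Real.pi * Complex.I / N ^ 2 * bernoulliFun 2 (frac (b * p))
          * (if d * p = 0 then 1 else 0)
          * (zetaHat (-(d * q)) 2 - zetaHat (d * q) 2) * (m * α) := by
  rw [cuspResidue_eq, add_eq_right]
  by_cases h : b * p = 0
  · have : d * p = 0 := by
      obtain ⟨e, rfl⟩ := hbd
      rw [mul_right_comm, h, zero_mul]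
    rw [this, frac_zero, bernoulliFun_three_zero]
    simp
  · simp [h]

end

end EisSymbol
end

/-! ### The main theorem -/

open EisSymbol
theorem mainTheorem3 (N : ℕ) [NeZero N] (hN : 3 ≤ N) :
    (∀ a b c d : ZMod N, (a, b) ≠ (0, 0) → ∀ α : ℝ,
      Tendsto (fun y : ℝ => shokurovIntegral 1 0 (y * Complex.I) (α + y * Complex.I)
          (eis01D ![a, b] ![c, d])) atTop
        (𝓝 (-(4 * Real.pi ^ 2 / N ^ 2) * (if a = 0 then 1 else 0)
              * Real.log ‖1 - zetaPow b‖ * bernoulliFun 3 (frac c) * α ^ 2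
            + 3 * Real.pi * Complex.I / N ^ 2 * bernoulliFun 2 (frac a) * (if c = 0 then 1 else 0)
              * (zetaHat (-d) 2 - zetaHat d 2) * α)) ∧
      Tendsto (fun y : ℝ => shokurovIntegral 0 1 (y * Complex.I) (α + y * Complex.I)
          (eis01D ![a, b] ![c, d])) atTop
        (𝓝 (-(8 * Real.pi ^ 2 / N ^ 2) * (if a = 0 then 1 else 0)
              * Real.log ‖1 - zetaPow b‖ * bernoulliFun 3 (frac c) * α))) ∧
    (∀ b b' d : ZMod N, b ≠ 0 → b' ≠ 0 → b ∣ d → b' ∣ d →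
      ((b.val : ℤ) ≡ b'.val [ZMOD (Nat.gcd d.val N : ℕ)] ∨
        (b.val : ℤ) ≡ -b'.val [ZMOD (Nat.gcd d.val N : ℕ)]) →
      HasTrivialResidues (eis01D ![0, b] ![0, d] - eis01D ![0, b'] ![0, d])) := by
  have hpull : ∀ ω : TwoForm N, pullback 1 ω = ω := fun ω => by
    funext h p
    have : glTranspose (1 : GL (Fin 2) (ZMod N)) = 1 := Units.ext (by simp [glTranspose])
    rw [pullback, this, mul_one]
  refine ⟨fun a b c d hab α => ?_, fun b b' d hb hb' hbd hbd' hmod g m n α => ?_⟩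
  · have hu : ![a, b] ≠ 0 := fun h => hab (by
      have h0 := congrFun h 0
      have h1 := congrFun h 1
      simp at h0 h1
      rw [h0, h1])
    have key := fun m n : ℤ => tendsto_shokurovIntegral_eis01D hu ![c, d] 1 m n α
    simp only [hpull, Units.val_one, Matrix.vecMul_one, cuspResidue_eq] at key
    constructor
    · convert! key 1 0 using 2
      push_cast
      ring
    · convert! key 0 1 using 2
      push_cast
      ring
  · have hne : ∀ b : ZMod N, b ≠ 0 → ![0, b] ≠ 0 := fun b hb h => hb (by
      simpa using congrFun h 1)
    have hrow : ∀ b : ZMod N, ![0, b] ᵥ* g.val = ![b * g.val 1 0, b * g.val 1 1] := fun b => by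
      ext i
      fin_cases i <;> simp [Matrix.vecMul, dotProduct, Fin.sum_univ_two]
    have key := tendsto_shokurovIntegral_eis01D_sub (hne b hb) (hne b' hb') ![0, d] g m n α
    rw [hrow, hrow, hrow, cuspResidue_eq_of_dvd hbd, cuspResidue_eq_of_dvd hbd'] at key
    convert! key using 2
    -- If `dp ≠ 0`, both residues already vanish; the congruence is needed only when `dp = 0`.
    by_cases h : d * g.val 1 0 = 0
    · rw [bernoulliFun_two_frac_eq_of_modEq h hmod, sub_self]
    · simp [h]
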